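/- Let $Y$ be a random vector in $\mathbb R^d$ with a probability density $f$ with respect to Lebesgue measure, let $S:\mathbb R^d\to\mathbb R$ be measurable, let $s\ge 2$ and $\tau\ge 1$ be integers, and let $\gamma_1<\dots<\gamma_\tau$ be real numbers with $\mathbb P(S(Y)\ge\gamma_\tau)>0$. For $1\le l<\tau$ let $\kappa_l$ be a Markov transition kernel on $\mathbb R^d$ for which the law of $Y$ conditional on $S(Y)\ge\gamma_l$ is stationary. One run of *generalized splitting* (GS) draws $Y$ from $f$ and lets the list $\mathcal X_1$ be $[Y]$ if $S(Y)\ge\gamma_1$ and the empty list otherwise. For $l=2,\dots,\tau$, independently from each state $y$ of the list $\mathcal X_{l-1}$ (counted with multiplicity), it simulates $s$ steps $Y_1,\dots,Y_s$ of the Markov chain with kernel $\kappa_{l-1}$ started at $Y_0=y$; the list $\mathcal X_l$ consists of all the states $Y_j$, $1\le j\le s$, so obtained with $S(Y_j)\ge\gamma_l$. The run returns $\mathcal X_\tau$. Let $\mathcal Y_1,\mathcal Y_2,\dots$ be independent random lists, each distributed as $\mathcal X_\tau$ conditional on $\mathcal X_\tau$ being non-empty. (This is the list that is obtained by repeating GS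 until the list returned is non-empty.) Let $$\widehat{\mathbb Q}_n(A)=\frac{\sum_{i=1}^n|\mathcal Y_i\cap A|}{\sum_{i=1}^n|\mathcal Y_i|},\qquad \mathbb Q(A)=\mathbb P(Y\in A\mid S(Y)\ge\gamma_\tau),$$ where $|\cdot|$ counts states with multiplicity; $\widehat{\mathbb Q}_n$ is the empirical distribution of all the states in $\mathcal Y_1,\dots,\mathcal Y_n$. Let $\mathcal A$ be a class of subsets of $\mathbb R^d$ such that one of the following holds: 1. $\mathcal A$ is a class of Borel sets with finite Vapnik–Chervonenkis dimension, and its signed empirical suprema are measurable: for all $n$ and all $\varepsilon_1,\dots,\varepsilon_n\in\{-1,1\}$ the function $(y_1,\dots,y_n)\mapsto\sup_{A\in\mathcal A}\bigl|\sum_{i=1}^n\varepsilon_i\mathbf 1_A(y_i)\bigr|$ on $(\mathbb R^d)^n$ is universally measurable (measurable for the completion of every Borel probability measure); or 2. $\mathcal A$ is the class of all convex subsets of $\mathbb R^d$, and for each $1\le l<\tau$ the kernel $\kappa_l$ has a transition density: for almost every $x$ under the law of $Y$ conditional on $S(Y)\ge\gamma_l$, $\kappa_l(\mathrm dy\mid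 x)=\kappa_l(y\mid x)\,\mathrm dy$. Then, with probability $1$, $$\sup_{A\in\mathcal A}\bigl|\widehat{\mathbb Q}_n(A)-\mathbb Q(A)\bigr|\longrightarrow 0\qquad\text{as } n\to\infty.$$ -/

import Mathlib

open MeasureTheory ProbabilityTheory Filter Topology
open scoped ENNReal

/-! ### Finite lists of points as a measurable space -/

/-- The σ-algebra on finite lists: a set `T` of lists is measurable iff for every length `n` the
set of tuples `v ∈ αⁿ` whose list of entries lies in `T` is measurable, i.e. `List α` is the
disjoint union of the product spaces `αⁿ`. -/
instance listMeasurableSpace {α : Type*} [MeasurableSpace α] : MeasurableSpace (List α) :=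
  ⨅ n : ℕ, MeasurableSpace.map (List.ofFn : (Fin n → α) → List α) MeasurableSpace.pi

/-! ### Generalized splitting -/

namespace GS

section Algorithm

variable {α : Type*}

/-- The sublist of the states of `L` whose importance `S` has reached the level `c`. -/
noncomputable def keep (S : α → ℝ) (c : ℝ) (L : List α) : List α :=
  L.filter fun y => decide (c ≤ S y)

variable [MeasurableSpace α]

/-- The law of the list `[Y₁, …, Yₙ]` of the first `n` states of the Markov chain with transition
kernel `κ` started from `Y₀ = x`. -/
noncomputable def chainLaw (κ : Kernel α α) : ℕ → α → Measure (List α)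
  | 0, _ => Measure.dirac []
  | n + 1, x => (κ x).bind fun y => (chainLaw κ n y).map (List.cons y)

/-- One pass of the splitting loop over a list of states: from each state, independently, run `s`
steps of the chain with kernel `κ`, and keep the visited states that have reached the level `c`.
This is the law of the list of all the kept states. -/
noncomputable def splitLaw (κ : Kernel α α) (s : ℕ) (S : α → ℝ) (c : ℝ) :
    List α → Measure (List α)
  | [] => Measure.dirac []
  | x :: xs => ((chainLaw κ s x).prod (splitLaw κ s S c xs)).map fun p => keep S c p.1 ++ p.2

/-- The law of the list `𝒳ₗ` of the states that have reached the level `γ l` in one run of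
generalized splitting with initial law `μ`, splitting factor `s`, importance function `S`, levels
`γ 1 < γ 2 < …` and kernels `κ 1, κ 2, …`. The list `𝒳₀` holds the initial state only, `𝒳₁` holds it
if it has reached the level `γ 1` and is empty otherwise, and `𝒳ₗ₊₁` arises from `𝒳ₗ` by one pass of
the splitting loop with the kernel `κ l` and the level `γ (l + 1)`. -/
noncomputable def levelLaw (μ : Measure α) (s : ℕ) (S : α → ℝ) (γ : ℕ → ℝ) (κ : ℕ → Kernel α α) :
    ℕ → Measure (List α)
  | 0 => μ.map fun y => [y]
  | 1 => μ.map fun y => keep S (γ 1) [y]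
  | l + 2 => (levelLaw μ s S γ κ (l + 1)).bind (splitLaw (κ (l + 1)) s S (γ (l + 2)))

/-- The law of the list returned by the sampler that repeats generalized splitting with `τ` levels
until the list of retained states is non-empty: the law of that list conditional on its being
non-empty. -/
noncomputable def samplerLaw (μ : Measure α) (s τ : ℕ) (S : α → ℝ) (γ : ℕ → ℝ)
    (κ : ℕ → Kernel α α) : Measure (List α) :=
  cond (levelLaw μ s S γ κ τ) {L | L ≠ []}

/-- The law of `Y ∼ μ` conditional on `S(Y) ≥ c`. -/
noncomputable def truncatedLaw (μ : Measure α) (S : α → ℝ) (c : ℝ) : Measure α :=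
  cond μ {y | c ≤ S y}

end Algorithm

open Classical in
/-- `H(A)`: the number of states of the list `L`, with multiplicity, that lie in `A`. -/
noncomputable def hits {α : Type*} (A : Set α) (L : List α) : ℕ :=
  L.countP fun y => decide (y ∈ A)

/-- `Q̂ₙ(A)`: the mass that the empirical distribution of the states in the first `n` lists (pooled,
with multiplicity) gives to `A`. -/
noncomputable def empirical {α : Type*} (Y : ℕ → List α) (n : ℕ) (A : Set α) : ℝ :=
  (∑ i ∈ Finset.range n, (hits A (Y i) : ℝ)) / ∑ i ∈ Finset.range n, ((Y i).length : ℝ)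

/-- The kernel `κ` has, from `μ`-almost every state, a density with respect to Lebesgue
measure. -/
def HasTransitionDensity {α : Type*} [MeasureSpace α] (κ : Kernel α α) (μ : Measure α) : Prop :=
  ∃ k : α → α → ℝ≥0∞, (∀ x, Measurable (k x)) ∧ ∀ᵐ x ∂μ, κ x = volume.withDensity (k x)

/-! ### Vapnik–Chervonenkis classes -/

/-- The class `𝒜` shatters the finite set `T`. -/
def Shatters {α : Type*} (𝒜 : Set (Set α)) (T : Finset α) : Prop :=
  ∀ U : Set α, U ⊆ (T : Set α) → ∃ A ∈ 𝒜, A ∩ (T : Set α) = U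

/-- The Vapnik–Chervonenkis dimension of the class `𝒜`: the supremum of the sizes of the finite
sets that it shatters. -/
noncomputable def vcDim {α : Type*} (𝒜 : Set (Set α)) : ℕ∞ :=
  ⨆ (T : Finset α) (_ : Shatters 𝒜 T), (T.card : ℕ∞)

/-- The suprema over `𝒜` of signed empirical counts are measurable: for all `n` and all signs
`ε₁, …, εₙ ∈ {-1, 1}` the function `(y₁, …, yₙ) ↦ sup_{A ∈ 𝒜} |∑ᵢ εᵢ 1_A(yᵢ)|` is universally
measurable, that is, measurable for the completion of every probability measure. -/
def IsMeasurableClass {α : Type*} [MeasurableSpace α] (𝒜 : Set (Set α)) : Prop :=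
  ∀ (n : ℕ) (ε : Fin n → ℝ), (∀ i, ε i = 1 ∨ ε i = -1) →
    ∀ ν : Measure (Fin n → α), IsProbabilityMeasure ν →
      AEMeasurable
        (fun y : Fin n → α => ⨆ A : 𝒜, |∑ i, ε i * (A : Set α).indicator (fun _ => (1 : ℝ)) (y i)|)
        ν

/-! ### The laws above are well defined

A push-forward or a bind of measures along a non-measurable map is zero by convention; the facts
below show that every map used above is measurable, so that all the laws are probability measures.
-/

section WellDefined

variable {α β γ : Type*} [MeasurableSpace α] [MeasurableSpace β] [MeasurableSpace γ]

theorem measurable_ofFn (n : ℕ) : Measurable (List.ofFn : (Fin n → α) → List α) :=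
  measurable_iff_le_map.2 (iInf_le _ n)

theorem measurableSet_list_iff {T : Set (List α)} :
    MeasurableSet T ↔ ∀ n, MeasurableSet ((List.ofFn : (Fin n → α) → List α) ⁻¹' T) := by
  change MeasurableSet[⨅ n : ℕ, MeasurableSpace.map (List.ofFn : (Fin n → α) → List α)
    MeasurableSpace.pi] T ↔ _
  rw [MeasurableSpace.measurableSet_iInf]
  rfl

theorem measurableEmbedding_ofFn (n : ℕ) :
    MeasurableEmbedding (List.ofFn : (Fin n → α) → List α) where
  injective := List.ofFn_injective
  measurable := measurable_ofFn n
  measurableSet_image' := by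
    intro t ht
    rw [measurableSet_list_iff]
    intro m
    by_cases h : m = n
    · subst h
      rwa [Set.preimage_image_eq _ List.ofFn_injective]
    · convert MeasurableSet.empty
      rw [Set.eq_empty_iff_forall_notMem]
      rintro v ⟨w, -, hw⟩
      exact h (by simpa using (congrArg List.length hw).symm)

theorem measurable_from_list {f : List α → β}
    (h : ∀ n, Measurable fun v : Fin n → α => f (List.ofFn v)) : Measurable f :=
  fun t ht => measurableSet_list_iff.2 fun n => h n ht

theorem measurable_from_prod_list {f : β × List α → γ}
    (h : ∀ n, Measurable fun p : β × (Fin n → α) => f (p.1, List.ofFn p.2)) : Measurable f := by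
  intro t ht
  have key : f ⁻¹' t = ⋃ n : ℕ, Prod.map id (List.ofFn : (Fin n → α) → List α) ''
      ((fun p : β × (Fin n → α) => f (p.1, List.ofFn p.2)) ⁻¹' t) := by
    ext ⟨b, L⟩
    simp only [Set.mem_preimage, Set.mem_iUnion, Set.mem_image, Prod.exists, Prod.map_apply, id,
      Prod.mk.injEq]
    constructor
    · intro hL
      exact ⟨L.length, b, L.get, by simpa using hL, rfl, by simp⟩
    · rintro ⟨n, b', v, hv, rfl, rfl⟩
      exact hv
  rw [key]
  exact MeasurableSet.iUnion fun n =>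
    (MeasurableEmbedding.id.prodMap (measurableEmbedding_ofFn n)).measurableSet_image.2 (h n ht)

theorem measurable_cons : Measurable fun p : α × List α => p.1 :: p.2 := by
  refine measurable_from_prod_list fun n => ?_
  have h : (fun p : α × (Fin n → α) => p.1 :: List.ofFn p.2) =
      fun p => List.ofFn (Fin.cons p.1 p.2 : Fin (n + 1) → α) := by
    funext p
    simp [List.ofFn_succ]
  rw [h]
  refine (measurable_ofFn (n + 1)).comp (measurable_pi_iff.2 fun i => ?_)
  refine Fin.cases ?_ (fun j => ?_) i
  · simpa using measurable_fst
  · simpa [Function.comp_def] using (measurable_pi_apply j).comp measurable_snd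

theorem measurable_keep_append {S : α → ℝ} (hS : Measurable S) (c : ℝ) :
    Measurable fun p : List α × List α => keep S c p.1 ++ p.2 := by
  suffices h : Measurable fun p : List α × List α => keep S c p.2 ++ p.1 from
    h.comp measurable_swap
  refine measurable_from_prod_list fun n => ?_
  induction n with
  | zero => simpa [keep] using measurable_fst
  | succ n ih =>
    have e : (fun p : List α × (Fin (n + 1) → α) => keep S c (List.ofFn p.2) ++ p.1) =
        fun p => if c ≤ S (p.2 0) then
          p.2 0 :: (keep S c (List.ofFn fun i : Fin n => p.2 i.succ) ++ p.1)
          else keep S c (List.ofFn fun i : Fin n => p.2 i.succ) ++ p.1 := by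
      funext p
      by_cases hc : c ≤ S (p.2 0) <;> simp [keep, List.ofFn_succ, hc]
    have h0 : Measurable fun p : List α × (Fin (n + 1) → α) => p.2 0 :=
      (measurable_pi_apply 0).comp measurable_snd
    have h1 : Measurable fun p : List α × (Fin (n + 1) → α) =>
        keep S c (List.ofFn fun i : Fin n => p.2 i.succ) ++ p.1 :=
      ih.comp (measurable_fst.prodMk
        (measurable_pi_iff.2 fun i => (measurable_pi_apply i.succ).comp measurable_snd))
    rw [e]
    exact Measurable.ite (measurableSet_le measurable_const (hS.comp h0))
      (measurable_cons.comp (h0.prodMk h1)) h1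

theorem measurable_chainLaw (κ : Kernel α α) [IsMarkovKernel κ] (n : ℕ) :
    Measurable (chainLaw κ n) ∧ ∀ x, IsProbabilityMeasure (chainLaw κ n x) := by
  induction n with
  | zero => exact ⟨measurable_const, fun x => by unfold chainLaw; infer_instance⟩
  | succ n ih =>
    obtain ⟨hm, hp⟩ := ih
    let K : Kernel α (List α) := ⟨chainLaw κ n, hm⟩
    have : IsMarkovKernel K := ⟨hp⟩
    have e : (fun y => (chainLaw κ n y).map (List.cons y)) =
        (Kernel.id ×ₖ K).map (fun p : α × List α => p.1 :: p.2) := by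
      funext y
      rw [Kernel.map_apply _ measurable_cons, Kernel.prod_apply, Kernel.id_apply,
        Measure.dirac_prod, Measure.map_map measurable_cons measurable_prodMk_left]
      rfl
    have hJ : Measurable fun y => (chainLaw κ n y).map (List.cons y) := by
      rw [e]
      exact Kernel.measurable _
    constructor
    · exact (Measure.measurable_bind' hJ).comp κ.measurable
    · intro x
      refine isProbabilityMeasure_bind hJ.aemeasurable (ae_of_all _ fun y => ?_)
      have := hp y
      exact Measure.isProbabilityMeasure_map
        (measurable_cons.comp measurable_prodMk_left).aemeasurable

theorem measurable_splitLaw (κ : Kernel α α) [IsMarkovKernel κ] (s : ℕ) {S : α → ℝ}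
    (hS : Measurable S) (c : ℝ) :
    Measurable (splitLaw κ s S c) ∧ ∀ L, IsProbabilityMeasure (splitLaw κ s S c L) := by
  have hp : ∀ L, IsProbabilityMeasure (splitLaw κ s S c L) := by
    intro L
    induction L with
    | nil => unfold splitLaw; infer_instance
    | cons x xs ih =>
      have := (measurable_chainLaw κ s).2 x
      unfold splitLaw
      exact Measure.isProbabilityMeasure_map (measurable_keep_append hS c).aemeasurable
  refine ⟨measurable_from_list fun n => ?_, hp⟩
  induction n with
  | zero =>
    simp only [List.ofFn_zero]
    exact measurable_const
  | succ n ih =>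
    let K : Kernel α (List α) := ⟨chainLaw κ s, (measurable_chainLaw κ s).1⟩
    have : IsMarkovKernel K := ⟨(measurable_chainLaw κ s).2⟩
    let R : Kernel (Fin n → α) (List α) := ⟨fun v => splitLaw κ s S c (List.ofFn v), ih⟩
    have : IsMarkovKernel R := ⟨fun v => hp _⟩
    have h0 : Measurable fun v : Fin (n + 1) → α => v 0 := measurable_pi_apply 0
    have h1 : Measurable fun (v : Fin (n + 1) → α) (i : Fin n) => v i.succ :=
      measurable_pi_iff.2 fun i => measurable_pi_apply i.succ
    have e : (fun v : Fin (n + 1) → α => splitLaw κ s S c (List.ofFn v)) =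
        ((K.comap _ h0) ×ₖ (R.comap _ h1)).map
          (fun p : List α × List α => keep S c p.1 ++ p.2) := by
      funext v
      rw [Kernel.map_apply _ (measurable_keep_append hS c), Kernel.prod_apply, List.ofFn_succ]
      rfl
    rw [e]
    exact Kernel.measurable _

theorem isProbabilityMeasure_levelLaw (μ : Measure α) [IsProbabilityMeasure μ] (s : ℕ) {S : α → ℝ}
    (hS : Measurable S) (γ : ℕ → ℝ) (κ : ℕ → Kernel α α) [∀ l, IsMarkovKernel (κ l)] (l : ℕ) :
    IsProbabilityMeasure (levelLaw μ s S γ κ l) := by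
  have hsingle : Measurable fun y : α => [y] :=
    measurable_cons.comp (measurable_id.prodMk measurable_const)
  have hkeep : ∀ c, Measurable fun y : α => keep S c [y] := fun c => by
    have h := (measurable_keep_append hS c).comp
      (hsingle.prodMk (measurable_const (a := ([] : List α))))
    simpa [Function.comp_def] using h
  induction l with
  | zero => exact Measure.isProbabilityMeasure_map hsingle.aemeasurable
  | succ l ih =>
    cases l with
    | zero => exact Measure.isProbabilityMeasure_map (hkeep (γ 1)).aemeasurable
    | succ l =>
      obtain ⟨hm, hp⟩ := measurable_splitLaw (κ (l + 1)) s hS (γ (l + 2))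
      exact isProbabilityMeasure_bind hm.aemeasurable (ae_of_all _ hp)

end WellDefined

end GS

/-! Splitting is unbiased. By stationarity, one pass multiplies by `s` the expected sum of a
function over the list, restricted to the next level (`lintegral_total_levelLaw`). The empty list
contains no hits, so conditioning on non-emptiness only rescales: the expected number of hits of `A`
in one returned list is `m * Q(A)`, where `m > 0` does not depend on `A` and is the mean length
(`integral_hits_samplerLaw`). States of one list are dependent, but the lists are i.i.d. and of
length at most `s ^ l` for `l + 1` levels. The strong law, applied to hits and to lengths, gives
convergence of the ratio for each fixed measurable set; the remaining issue is uniformity.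

For a Vapnik–Chervonenkis class, the sample is compared with an independent ghost sample. Exchanging
the `i`-th lists of both samples preserves the joint law and flips the sign of the `i`-th difference
of hits. For fixed data the two samples contain at most `2nM` points, on which the class has
polynomially many traces (Sauer–Shelah), and Hoeffding's inequality bounds the proportion of bad
sign patterns for each trace. Whole lists are swapped, so dependence inside a list is harmless. The
resulting tail bound is summable (`measure_lt_disc_le`), Borel–Cantelli applies, and integrating out
the ghost sample replaces its average by the mean (`ae_exists_uniform_bound`).

For convex sets, `Q` is absolutely continuous and so does not charge their boundaries. Compactness
of the compact convex subsets of a ball in the Hausdorff distance gives finitely many brackets of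
small `Q`-mass (`exists_finite_brackets`), and convergence on the bracket endpoints suffices. -/

namespace GS

/-! ### Sums and counts over lists. -/

section Counting

variable {α : Type*}

/-- The sum of `g` over the states of a list, with multiplicity. -/
noncomputable def total (g : α → ℝ≥0∞) (L : List α) : ℝ≥0∞ := (L.map g).sum

theorem total_append (g : α → ℝ≥0∞) (L L' : List α) :
    total g (L ++ L') = total g L + total g L' := by
  simp [total]

/-- Moving the filter into the weight lets the expectation of a pass be computed from the unfiltered
chain. -/
theorem total_keep (g : α → ℝ≥0∞) (S : α → ℝ) (c : ℝ) (L : List α) :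
    total g (keep S c L) = total ({y | c ≤ S y}.indicator g) L := by
  induction L with
  | nil => simp [total, keep]
  | cons x xs ih =>
    simp only [total, keep] at ih ⊢
    by_cases h : c ≤ S x <;> simp [h, ih]

theorem total_indicator_one (A : Set α) (L : List α) :
    total (A.indicator 1) L = (hits A L : ℝ≥0∞) := by
  induction L with
  | nil => simp [total, hits]
  | cons x xs ih =>
    simp only [total, hits] at ih ⊢
    by_cases h : x ∈ A <;> simp [h, ih, add_comm]

theorem hits_univ (L : List α) : hits Set.univ L = L.length := by simp [hits]

theorem hits_le_length (A : Set α) (L : List α) : hits A L ≤ L.length := List.countP_le_length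

theorem hits_mono {A B : Set α} (h : A ⊆ B) (L : List α) : hits A L ≤ hits B L :=
  List.countP_mono_left fun x _ hx => by simpa using h (by simpa using hx)

end Counting

/-! ### Length bounds and unbiasedness of generalized splitting. -/

section ListLaws

variable {α : Type*} [MeasurableSpace α]

theorem measurable_total {g : α → ℝ≥0∞} (hg : Measurable g) : Measurable (total g) := by
  refine measurable_from_list fun n => ?_
  simp only [total, List.map_ofFn, List.sum_ofFn, Function.comp_apply]
  exact Finset.measurable_sum _ fun i _ => hg.comp (measurable_pi_apply i)

theorem measurable_length : Measurable (List.length : List α → ℕ) := by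
  refine measurable_from_list fun n => ?_
  simp only [List.length_ofFn]
  exact measurable_const

theorem measurable_hits {A : Set α} (hA : MeasurableSet A) : Measurable (hits A) := by
  classical
  refine measurable_from_list fun n => ?_
  have e : (fun v : Fin n → α => hits A (List.ofFn v)) =
      fun v => ∑ i, A.indicator (fun _ => 1) (v i) := by
    funext v
    have h := total_indicator_one A (List.ofFn v)
    simp only [total, List.map_ofFn, List.sum_ofFn, Function.comp_apply] at h
    have h2 : ((∑ i, A.indicator (fun _ => 1) (v i) : ℕ) : ℝ≥0∞) = hits A (List.ofFn v) := by
      rw [← h]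
      push_cast
      refine Finset.sum_congr rfl fun i _ => ?_
      by_cases hi : v i ∈ A <;> simp [hi]
    exact_mod_cast h2.symm
  rw [e]
  exact Finset.measurable_sum _ fun i _ =>
    (measurable_const.indicator hA).comp (measurable_pi_apply i)

theorem measurableSet_length_le (n : ℕ) : MeasurableSet {L : List α | L.length ≤ n} :=
  measurable_length measurableSet_Iic

theorem ae_bind_of_ae_ae {β : Type*} [MeasurableSpace β] {μ : Measure α} {k : α → Measure β}
    (hk : Measurable k) {p : β → Prop} (hp : MeasurableSet {z | p z})
    (h : ∀ᵐ y ∂μ, ∀ᵐ z ∂k y, p z) : ∀ᵐ z ∂μ.bind k, p z := by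
  rw [ae_iff, ← Set.compl_ofPred, Measure.bind_apply hp.compl hk.aemeasurable,
    lintegral_congr_ae (g := 0)]
  · simp
  · exact h

theorem measurable_chainLaw_cons (κ : Kernel α α) [IsMarkovKernel κ] (n : ℕ) :
    Measurable fun y => (chainLaw κ n y).map (List.cons y) := by
  let K : Kernel α (List α) := ⟨chainLaw κ n, (measurable_chainLaw κ n).1⟩
  have : IsMarkovKernel K := ⟨(measurable_chainLaw κ n).2⟩
  have e : (fun y => (chainLaw κ n y).map (List.cons y)) =
      (Kernel.id ×ₖ K).map (fun p : α × List α => p.1 :: p.2) := by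
    funext y
    rw [Kernel.map_apply _ measurable_cons, Kernel.prod_apply, Kernel.id_apply,
      Measure.dirac_prod, Measure.map_map measurable_cons measurable_prodMk_left]
    rfl
  rw [e]
  exact Kernel.measurable _

theorem measurable_cons_left (y : α) : Measurable (List.cons y) :=
  measurable_cons.comp measurable_prodMk_left

theorem lintegral_chainLaw_succ (κ : Kernel α α) [IsMarkovKernel κ] (n : ℕ) (x : α)
    {G : List α → ℝ≥0∞} (hG : Measurable G) :
    ∫⁻ L, G L ∂chainLaw κ (n + 1) x = ∫⁻ y, ∫⁻ L, G (y :: L) ∂chainLaw κ n y ∂κ x := by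
  rw [chainLaw, Measure.lintegral_bind (measurable_chainLaw_cons κ n).aemeasurable hG.aemeasurable]
  refine lintegral_congr fun y => ?_
  rw [lintegral_map hG (measurable_cons_left y)]

theorem ae_length_chainLaw (κ : Kernel α α) [IsMarkovKernel κ] (n : ℕ) (x : α) :
    ∀ᵐ L ∂chainLaw κ n x, L.length = n := by
  induction n generalizing x with
  | zero =>
    rw [chainLaw, ae_dirac_iff (show MeasurableSet {L : List α | L.length = 0} from
      measurable_length (measurableSet_singleton 0))]
    rfl
  | succ n ih =>
    have hm : MeasurableSet {L : List α | L.length = n + 1} :=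
      measurable_length (measurableSet_singleton (n + 1))
    refine ae_bind_of_ae_ae (measurable_chainLaw_cons κ n) hm (ae_of_all _ fun y => ?_)
    rw [ae_map_iff (measurable_cons_left y).aemeasurable hm]
    filter_upwards [ih y] with L hL
    simp [hL]

theorem ae_length_splitLaw (κ : Kernel α α) [IsMarkovKernel κ] (s : ℕ) {S : α → ℝ}
    (hS : Measurable S) (c : ℝ) (L : List α) :
    ∀ᵐ L' ∂splitLaw κ s S c L, L'.length ≤ s * L.length := by
  induction L with
  | nil =>
    rw [splitLaw, ae_dirac_iff (measurableSet_length_le _)]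
    simp
  | cons x xs ih =>
    have := (measurable_splitLaw κ s hS c).2 xs
    have := (measurable_chainLaw κ s).2 x
    rw [splitLaw, ae_map_iff (measurable_keep_append hS c).aemeasurable
      (measurableSet_length_le _)]
    have h1 := Measure.quasiMeasurePreserving_fst (μ := chainLaw κ s x)
      (ν := splitLaw κ s S c xs) |>.ae (ae_length_chainLaw κ s x)
    have h2 := Measure.quasiMeasurePreserving_snd (μ := chainLaw κ s x)
      (ν := splitLaw κ s S c xs) |>.ae ih
    filter_upwards [h1, h2] with p hp1 hp2
    have h3 : (keep S c p.1).length ≤ p.1.length := List.length_filter_le _ _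
    rw [List.length_append, List.length_cons, mul_add]
    lia

theorem measurable_singleton_list : Measurable fun y : α => [y] :=
  measurable_cons.comp (measurable_id.prodMk measurable_const)

theorem measurable_keep_singleton {S : α → ℝ} (hS : Measurable S) (c : ℝ) :
    Measurable fun y : α => keep S c [y] := by
  have h := (measurable_keep_append hS c).comp
    (measurable_singleton_list.prodMk (measurable_const (a := ([] : List α))))
  simpa [Function.comp_def] using h

/-- Each pass multiplies the length by at most `s`. This deterministic bound later supplies
integrability, the constant in Hoeffding's inequality and the dominating function. -/
theorem ae_length_levelLaw (μ : Measure α) (s : ℕ) {S : α → ℝ} (hS : Measurable S) (γ : ℕ → ℝ)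
    (κ : ℕ → Kernel α α) [∀ l, IsMarkovKernel (κ l)] (l : ℕ) :
    ∀ᵐ L ∂levelLaw μ s S γ κ (l + 1), L.length ≤ s ^ l := by
  induction l with
  | zero =>
    rw [levelLaw, ae_map_iff (measurable_keep_singleton hS _).aemeasurable
      (measurableSet_length_le _)]
    exact ae_of_all _ fun y => (List.length_filter_le _ _).trans (by simp)
  | succ l ih =>
    refine ae_bind_of_ae_ae (measurable_splitLaw _ s hS _).1 (measurableSet_length_le _) ?_
    filter_upwards [ih] with L hL
    filter_upwards [ae_length_splitLaw (κ (l + 1)) s hS (γ (l + 2)) L] with L' hL'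
    calc L'.length ≤ s * L.length := hL'
      _ ≤ s * s ^ l := by gcongr
      _ = s ^ (l + 1) := by ring

/-- Under the stationary law, the expected sum of `g` over the first `n` states is `n ∫ g`. -/
theorem lintegral_total_chainLaw (κ : Kernel α α) [IsMarkovKernel κ] {π : Measure α}
    (hπ : κ.Invariant π) {g : α → ℝ≥0∞} (hg : Measurable g) (n : ℕ) :
    ∫⁻ x, ∫⁻ L, total g L ∂chainLaw κ n x ∂π = n * ∫⁻ x, g x ∂π := by
  have hinv : ∀ {h : α → ℝ≥0∞}, Measurable h → ∫⁻ x, ∫⁻ y, h y ∂κ x ∂π = ∫⁻ x, h x ∂π := by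
    intro h hh
    rw [← Measure.lintegral_bind κ.measurable.aemeasurable hh.aemeasurable, hπ.def]
  induction n with
  | zero =>
    simp only [chainLaw, lintegral_dirac' _ (measurable_total hg)]
    simp [total]
  | succ n ih =>
    have hm : Measurable fun y => ∫⁻ L, total g L ∂chainLaw κ n y :=
      (Measure.measurable_lintegral (measurable_total hg)).comp (measurable_chainLaw κ n).1
    have e : ∀ x, ∫⁻ L, total g L ∂chainLaw κ (n + 1) x =
        ∫⁻ y, (g y + ∫⁻ L, total g L ∂chainLaw κ n y) ∂κ x := by
      intro x
      rw [lintegral_chainLaw_succ κ n x (measurable_total hg)]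
      refine lintegral_congr fun y => ?_
      have := (measurable_chainLaw κ n).2 y
      simp [total, lintegral_add_left measurable_const]
    simp_rw [e]
    -- By invariance the state after the first step again has law `π`, so the remaining `n` steps
    -- fall under the induction hypothesis.
    have h2 := hinv (hg.add hm)
    simp only [Pi.add_apply] at h2
    rw [h2, lintegral_add_left hg, ih]
    push_cast
    ring

/-- Expectation is additive over the starting states: each contributes the mean over its own chain,
with the level condition absorbed into the weight. -/
theorem lintegral_total_splitLaw (κ : Kernel α α) [IsMarkovKernel κ] (s : ℕ) {S : α → ℝ}
    (hS : Measurable S) (c : ℝ) {g : α → ℝ≥0∞} (hg : Measurable g) (L : List α) :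
    ∫⁻ L', total g L' ∂splitLaw κ s S c L =
      total (fun x => ∫⁻ L', total ({y | c ≤ S y}.indicator g) L' ∂chainLaw κ s x) L := by
  induction L with
  | nil =>
    simp only [splitLaw, lintegral_dirac' _ (measurable_total hg)]
    simp [total]
  | cons x xs ih =>
    have := (measurable_splitLaw κ s hS c).2 xs
    have := (measurable_chainLaw κ s).2 x
    have hg' : Measurable ({y | c ≤ S y}.indicator g) := hg.indicator (hS measurableSet_Ici)
    rw [splitLaw, lintegral_map (measurable_total hg) (measurable_keep_append hS c)]
    simp_rw [total_append, total_keep]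
    rw [lintegral_prod _ (by
      exact (((measurable_total hg').comp measurable_fst).add
        ((measurable_total hg).comp measurable_snd)).aemeasurable)]
    simp only [lintegral_add_left measurable_const, lintegral_const, measure_univ, mul_one, ih]
    rw [lintegral_add_right _ measurable_const]
    simp [total]

/-- Generalized splitting is unbiased. -/
theorem lintegral_total_levelLaw (μ : Measure α) [IsProbabilityMeasure μ] (s τ : ℕ) {S : α → ℝ}
    (hS : Measurable S) {γ : ℕ → ℝ} (hγ : StrictMonoOn γ (Set.Icc 1 τ)) (κ : ℕ → Kernel α α)
    [∀ l, IsMarkovKernel (κ l)]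
    (hκ : ∀ l, 1 ≤ l → l < τ → (κ l).Invariant (truncatedLaw μ S (γ l)))
    (l : ℕ) (hl : l + 1 ≤ τ) {g : α → ℝ≥0∞} (hg : Measurable g) :
    ∫⁻ L, total g L ∂levelLaw μ s S γ κ (l + 1) = s ^ l * ∫⁻ y in {y | γ (l + 1) ≤ S y}, g y ∂μ := by
  induction l generalizing g with
  | zero =>
    rw [levelLaw, lintegral_map (measurable_total hg) (measurable_keep_singleton hS _),
      ← lintegral_indicator (show MeasurableSet {y | γ (0 + 1) ≤ S y} from hS measurableSet_Ici)]
    simp only [total_keep]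
    simp [total]
  | succ l ih =>
    have hc : ∀ c, MeasurableSet {y | c ≤ S y} := fun c => hS measurableSet_Ici
    set g' := {y | γ (l + 2) ≤ S y}.indicator g with hg'_def
    have hg' : Measurable g' := hg.indicator (hc _)
    have hm : Measurable fun x => ∫⁻ L', total g' L' ∂chainLaw (κ (l + 1)) s x :=
      (Measure.measurable_lintegral (measurable_total hg')).comp (measurable_chainLaw _ s).1
    have hlt : γ (l + 1) < γ (l + 2) := hγ ⟨by lia, by lia⟩ ⟨by lia, by lia⟩ (by lia)
    rw [levelLaw, Measure.lintegral_bind (measurable_splitLaw _ s hS _).1.aemeasurable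
      (measurable_total hg).aemeasurable]
    simp_rw [lintegral_total_splitLaw _ s hS _ hg]
    rw [ih (by lia) hm]
    have hinv := lintegral_total_chainLaw (κ (l + 1)) (hκ (l + 1) (by lia) (by lia)) hg' s
    have key : ∫⁻ x in {y | γ (l + 1) ≤ S y}, ∫⁻ L', total g' L' ∂chainLaw (κ (l + 1)) s x ∂μ =
        s * ∫⁻ x in {y | γ (l + 1) ≤ S y}, g' x ∂μ := by
      -- On a null level both sides vanish; otherwise the normalising constant of the conditional
      -- law is finite and nonzero, and cancels.
      by_cases h0 : μ {y | γ (l + 1) ≤ S y} = 0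
      · simp [Measure.restrict_eq_zero.2 h0]
      · simp only [truncatedLaw, ProbabilityTheory.cond, lintegral_smul_measure, smul_eq_mul] at hinv
        rw [mul_left_comm] at hinv
        exact (ENNReal.mul_right_inj (by simp) (ENNReal.inv_ne_top.2 h0)).1 hinv
    rw [key, hg'_def, lintegral_indicator (hc _), Measure.restrict_restrict (hc _)]
    -- The levels are nested, so restricting to the lower one loses none of the mass of `g'`.
    have : {y | γ (l + 2) ≤ S y} ∩ {y | γ (l + 1) ≤ S y} = {y | γ (l + 2) ≤ S y} :=
      Set.inter_eq_left.2 fun y hy => hlt.le.trans hy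
    rw [this]
    ring

end ListLaws

/-! ### The law conditional on a non-empty list. -/

section SamplerLength

variable {α : Type*} [MeasurableSpace α] {μ : Measure α} {s l : ℕ} {S : α → ℝ} {γ : ℕ → ℝ}
  {κ : ℕ → Kernel α α} [∀ l, IsMarkovKernel (κ l)]

theorem ae_length_samplerLaw (hS : Measurable S) :
    ∀ᵐ L ∂samplerLaw μ s (l + 1) S γ κ, L.length ≤ s ^ l :=
  cond_absolutelyContinuous.ae_le (ae_length_levelLaw μ s hS γ κ l)

end SamplerLength

section Sampler

variable {α : Type*} [MeasurableSpace α] {μ : Measure α} [IsProbabilityMeasure μ] {s l : ℕ}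
  {S : α → ℝ} {γ : ℕ → ℝ} {κ : ℕ → Kernel α α} [∀ l, IsMarkovKernel (κ l)]

theorem measurableSet_ne_nil : MeasurableSet {L : List α | L ≠ []} := by
  have h : MeasurableSet {L : List α | L.length ≤ 0}ᶜ := (measurableSet_length_le 0).compl
  convert h using 1
  ext L
  simp

theorem lintegral_hits_levelLaw (hS : Measurable S) (hγ : StrictMonoOn γ (Set.Icc 1 (l + 1)))
    (hκ : ∀ i, 1 ≤ i → i < l + 1 → (κ i).Invariant (truncatedLaw μ S (γ i)))
    {A : Set α} (hA : MeasurableSet A) :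
    ∫⁻ L, (hits A L : ℝ≥0∞) ∂levelLaw μ s S γ κ (l + 1) =
      s ^ l * μ ({y | γ (l + 1) ≤ S y} ∩ A) := by
  simp_rw [← total_indicator_one]
  rw [lintegral_total_levelLaw μ s (l + 1) hS hγ κ hκ l le_rfl (measurable_one.indicator hA),
    lintegral_indicator_one hA, Measure.restrict_apply hA, Set.inter_comm]

/-- An almost surely empty list would have mean length zero, whereas unbiasedness gives `s ^ l * μ
{S ≥ γ (l + 1)} > 0`. -/
theorem levelLaw_ne_nil_ne_zero (hS : Measurable S) (hs : s ≠ 0)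
    (hγ : StrictMonoOn γ (Set.Icc 1 (l + 1)))
    (hκ : ∀ i, 1 ≤ i → i < l + 1 → (κ i).Invariant (truncatedLaw μ S (γ i)))
    (hpos : 0 < μ {y | γ (l + 1) ≤ S y}) :
    levelLaw μ s S γ κ (l + 1) {L | L ≠ []} ≠ 0 := by
  intro h
  have h1 : ∀ᵐ L ∂levelLaw μ s S γ κ (l + 1), (hits Set.univ L : ℝ≥0∞) = 0 := by
    filter_upwards [measure_eq_zero_iff_ae_notMem.1 h] with L hL
    have : L = [] := by simpa using hL
    simp [this, hits]
  have h2 := lintegral_hits_levelLaw (s := s) hS hγ hκ MeasurableSet.univ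
  rw [lintegral_congr_ae h1, lintegral_zero, Set.inter_univ] at h2
  have := mul_eq_zero.1 h2.symm
  simp [hs, hpos.ne'] at this

theorem isProbabilityMeasure_samplerLaw (hS : Measurable S) (hs : s ≠ 0)
    (hγ : StrictMonoOn γ (Set.Icc 1 (l + 1)))
    (hκ : ∀ i, 1 ≤ i → i < l + 1 → (κ i).Invariant (truncatedLaw μ S (γ i)))
    (hpos : 0 < μ {y | γ (l + 1) ≤ S y}) :
    IsProbabilityMeasure (samplerLaw μ s (l + 1) S γ κ) := by
  have := isProbabilityMeasure_levelLaw μ s hS γ κ (l + 1)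
  exact cond_isProbabilityMeasure (levelLaw_ne_nil_ne_zero hS hs hγ hκ hpos)

theorem lintegral_hits_samplerLaw (hS : Measurable S)
    (hγ : StrictMonoOn γ (Set.Icc 1 (l + 1)))
    (hκ : ∀ i, 1 ≤ i → i < l + 1 → (κ i).Invariant (truncatedLaw μ S (γ i)))
    {A : Set α} (hA : MeasurableSet A) :
    ∫⁻ L, (hits A L : ℝ≥0∞) ∂samplerLaw μ s (l + 1) S γ κ =
      (levelLaw μ s S γ κ (l + 1) {L | L ≠ []})⁻¹ * (s ^ l * μ ({y | γ (l + 1) ≤ S y} ∩ A)) := by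
  rw [samplerLaw, ProbabilityTheory.cond, lintegral_smul_measure, smul_eq_mul,
    ← lintegral_indicator measurableSet_ne_nil, ← lintegral_hits_levelLaw hS hγ hκ hA]
  congr 1
  -- The empty list has no hits, so restricting to non-empty lists does not change the integral.
  refine lintegral_congr fun L => ?_
  rcases L with _ | ⟨x, L⟩ <;> simp [hits]

theorem measurable_hits_real {A : Set α} (hA : MeasurableSet A) :
    Measurable fun L => (hits A L : ℝ) :=
  (measurable_from_top (f := fun n : ℕ => (n : ℝ))).comp (measurable_hits hA)

theorem integrable_hits {ν : Measure (List α)} [IsFiniteMeasure ν] {M : ℕ}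
    (hM : ∀ᵐ L ∂ν, L.length ≤ M) {A : Set α} (hA : MeasurableSet A) :
    Integrable (fun L => (hits A L : ℝ)) ν := by
  refine Integrable.of_bound (measurable_hits_real hA).aestronglyMeasurable (M : ℝ) ?_
  filter_upwards [hM] with L hL
  simpa using (hits_le_length A L).trans hL

/-- The expected number of hits of `A` of the sampler is proportional to the target law. -/
theorem integral_hits_samplerLaw (hS : Measurable S) (hs : s ≠ 0)
    (hγ : StrictMonoOn γ (Set.Icc 1 (l + 1)))
    (hκ : ∀ i, 1 ≤ i → i < l + 1 → (κ i).Invariant (truncatedLaw μ S (γ i)))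
    (hpos : 0 < μ {y | γ (l + 1) ≤ S y}) :
    ∃ m : ℝ, 0 < m ∧ ∀ A : Set α, MeasurableSet A →
      ∫ L, (hits A L : ℝ) ∂samplerLaw μ s (l + 1) S γ κ =
        m * (truncatedLaw μ S (γ (l + 1))).real A := by
  have hp := isProbabilityMeasure_levelLaw μ s hS γ κ (l + 1)
  have hp0 := levelLaw_ne_nil_ne_zero hS hs hγ hκ hpos
  set p := levelLaw μ s S γ κ (l + 1) {L | L ≠ []} with hp_def
  have hptop : p ≠ ∞ := measure_ne_top _ _
  have hmeas : MeasurableSet {y | γ (l + 1) ≤ S y} := hS measurableSet_Ici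
  -- This is the mean length of a returned list: the unconditional mean length divided by the
  -- probability of a non-empty list.
  refine ⟨p.toReal⁻¹ * (s ^ l * μ.real {y | γ (l + 1) ≤ S y}), ?_, fun A hA => ?_⟩
  · have h1 : 0 < p.toReal := ENNReal.toReal_pos hp0 hptop
    have h2 : 0 < μ.real {y | γ (l + 1) ≤ S y} := ENNReal.toReal_pos hpos.ne' (measure_ne_top _ _)
    have h3 : (0 : ℝ) < s := by positivity
    positivity
  · rw [integral_eq_lintegral_of_nonneg_ae (ae_of_all _ fun L => Nat.cast_nonneg _)
      (measurable_hits_real hA).aestronglyMeasurable]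
    simp only [ENNReal.ofReal_natCast]
    rw [lintegral_hits_samplerLaw hS hγ hκ hA, truncatedLaw,
      measureReal_def (μ[|{y | γ (l + 1) ≤ S y}]) A, cond_apply hmeas]
    have h1 : p.toReal ≠ 0 := (ENNReal.toReal_pos hp0 hptop).ne'
    have h2 : (μ {y | γ (l + 1) ≤ S y}).toReal ≠ 0 :=
      (ENNReal.toReal_pos hpos.ne' (measure_ne_top _ _)).ne'
    simp only [ENNReal.toReal_mul, ENNReal.toReal_inv, ENNReal.toReal_pow, ENNReal.toReal_natCast,
      ← hp_def, measureReal_def]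
    field_simp

end Sampler

/-! ### The strong law on the canonical product space. -/

section LawOfLargeNumbers

variable {α : Type*} [MeasurableSpace α]

theorem ae_tendsto_average {β : Type*} [MeasurableSpace β] (ν : Measure β) [IsProbabilityMeasure ν]
    {g : β → ℝ} (hg : Measurable g) (hint : Integrable g ν) :
    ∀ᵐ y ∂Measure.infinitePi (fun _ : ℕ => ν),
      Tendsto (fun n : ℕ => (∑ i ∈ Finset.range n, g (y i)) / n) atTop (𝓝 (∫ x, g x ∂ν)) := by
  have hev : ∀ i, MeasurePreserving (Function.eval i) (Measure.infinitePi (fun _ : ℕ => ν)) ν :=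
    fun i => measurePreserving_eval_infinitePi (fun _ : ℕ => ν) i
  have hi := iIndepFun_infinitePi (P := fun _ : ℕ => ν) (X := fun _ => g) (fun _ => hg)
  have h := strong_law_ae_real (μ := Measure.infinitePi (fun _ : ℕ => ν))
    (fun i y => g (y i)) ((hev 0).integrable_comp_of_integrable hint)
    (fun i j hij => hi.indepFun hij) (fun i =>
      { aemeasurable_fst := (hg.comp (measurable_pi_apply i)).aemeasurable
        aemeasurable_snd := (hg.comp (measurable_pi_apply 0)).aemeasurable
        map_eq := by
          change Measure.map (g ∘ (Function.eval i : (ℕ → β) → β)) _ = Measure.map (g ∘ (Function.eval 0 : (ℕ → β) → β)) _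
          rw [← Measure.map_map hg (hev i).measurable, (hev i).map_eq,
            ← Measure.map_map hg (hev 0).measurable, (hev 0).map_eq] })
  have e : ∫ y, g (y 0) ∂Measure.infinitePi (fun _ : ℕ => ν) = ∫ x, g x ∂ν := by
    conv_rhs => rw [← (hev 0).map_eq]
    rw [integral_map (hev 0).measurable.aemeasurable hg.aestronglyMeasurable]
  rw [e] at h
  exact h

theorem ae_tendsto_hits (ν : Measure (List α)) [IsProbabilityMeasure ν] {M : ℕ}
    (hM : ∀ᵐ L ∂ν, L.length ≤ M) {A : Set α} (hA : MeasurableSet A) :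
    ∀ᵐ y ∂Measure.infinitePi (fun _ : ℕ => ν),
      Tendsto (fun n : ℕ => (∑ i ∈ Finset.range n, (hits A (y i) : ℝ)) / n) atTop
        (𝓝 (∫ L, (hits A L : ℝ) ∂ν)) :=
  ae_tendsto_average ν (measurable_hits_real hA) (integrable_hits hM hA)

end LawOfLargeNumbers

/-! ### Sauer–Shelah and Hoeffding's inequality for random signs. -/

section Combinatorics

variable {α : Type*}

theorem sum_Iic_choose_le (N d k : ℕ) (hk : k ≤ d) :
    ∑ j ∈ Finset.Iic k, N.choose j ≤ (d + 1) * (N + 1) ^ d := by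
  calc ∑ j ∈ Finset.Iic k, N.choose j ≤ ∑ j ∈ Finset.Iic k, (N + 1) ^ d := by
        refine Finset.sum_le_sum fun j hj => (Nat.choose_le_pow N j).trans ?_
        have hj' : j ≤ d := (Finset.mem_Iic.1 hj).trans hk
        exact (Nat.pow_le_pow_left N.le_succ j).trans (Nat.pow_le_pow_right N.succ_pos hj')
    _ = (k + 1) * (N + 1) ^ d := by simp
    _ ≤ _ := by gcongr

/-- The Sauer–Shelah lemma: a class of Vapnik–Chervonenkis dimension at most `d` has polynomially
many traces on a finite set. -/
theorem exists_trace_representatives {𝒜 : Set (Set α)} {d : ℕ} (h𝒜 : vcDim 𝒜 ≤ d) (T : Finset α) :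
    ∃ ℬ : Finset (Set α), ↑ℬ ⊆ 𝒜 ∧ ℬ.card ≤ (d + 1) * (T.card + 1) ^ d ∧
      ∀ A ∈ 𝒜, ∃ B ∈ ℬ, ∀ x ∈ T, x ∈ A ↔ x ∈ B := by
  classical
  let F : Finset (Finset T) := Finset.univ.filter fun U => ∃ A ∈ 𝒜, ∀ x : T, x ∈ U ↔ (x : α) ∈ A
  have hF : ∀ U ∈ F, ∃ A ∈ 𝒜, ∀ x : T, x ∈ U ↔ (x : α) ∈ A := fun U hU =>
    (Finset.mem_filter.1 hU).2
  choose! rep hrep using hF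
  refine ⟨F.image rep, ?_, ?_, fun A hA => ?_⟩
  · intro B hB
    obtain ⟨U, hU, rfl⟩ := Finset.mem_image.1 (Finset.mem_coe.1 hB)
    exact (hrep U hU).1
  · have hdim : F.vcDim ≤ d := by
      refine Finset.sup_le fun s hs => ?_
      rw [Finset.mem_shatterer] at hs
      -- A set shattered by the traces on `T` is shattered by `𝒜` itself, so the dimension of the
      -- finite family is at most `d`.
      have hsh : Shatters 𝒜 (s.map (Function.Embedding.subtype _)) := by
        intro U hU
        obtain ⟨u, hu, hsu⟩ := hs (t := s.filter fun x => (x : α) ∈ U) (Finset.filter_subset _ _)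
        obtain ⟨A, hA, hAu⟩ := (Finset.mem_filter.1 hu).2
        refine ⟨A, hA, ?_⟩
        have key : ∀ x ∈ s, ((x : α) ∈ A ↔ (x : α) ∈ U) := by
          intro x hx
          have := congrArg (x ∈ ·) hsu
          simp only [Finset.mem_inter, hx, true_and, Finset.mem_filter, eq_iff_iff] at this
          rw [← this, hAu]
        ext x
        constructor
        · rintro ⟨hxA, hxs⟩
          obtain ⟨z, hz, rfl⟩ := Finset.mem_map.1 (Finset.mem_coe.1 hxs)
          exact (key z hz).1 hxA
        · intro hxU
          obtain ⟨z, hz, rfl⟩ := Finset.mem_map.1 (Finset.mem_coe.1 (hU hxU))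
          exact ⟨(key z hz).2 hxU, hU hxU⟩
      have h1 : ((s.map (Function.Embedding.subtype _)).card : ℕ∞) ≤ d :=
        (le_iSup₂ (f := fun (T : Finset α) (_ : Shatters 𝒜 T) => (T.card : ℕ∞)) _ hsh).trans h𝒜
      simpa using h1
    calc (F.image rep).card ≤ F.card := Finset.card_image_le
      _ ≤ F.shatterer.card := Finset.card_le_card_shatterer F
      _ ≤ ∑ k ∈ Finset.Iic F.vcDim, (Fintype.card T).choose k := Finset.card_shatterer_le_sum_vcDim
      _ ≤ _ := by
        rw [Fintype.card_coe]
        exact sum_Iic_choose_le _ _ _ hdim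
  · let U : Finset T := Finset.univ.filter fun x => (x : α) ∈ A
    have hU : U ∈ F := Finset.mem_filter.2 ⟨Finset.mem_univ _, A, hA, fun x => by simp [U]⟩
    refine ⟨rep U, Finset.mem_image_of_mem _ hU, fun x hx => ?_⟩
    have := (hrep U hU).2 ⟨x, hx⟩
    simpa [U] using this

/-- The sign `±1` that encodes a Boolean. -/
def sign (b : Bool) : ℝ := if b then 1 else -1

/-- The sum over sign patterns factorises into a product of terms `2 cosh (a i)`, and `cosh x ≤ exp
(x² / 2)`. -/
theorem sum_exp_sign_le {n : ℕ} (a : Fin n → ℝ) {c : ℝ} (ha : ∀ i, |a i| ≤ c) :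
    ∑ σ : Fin n → Bool, Real.exp (∑ i, sign (σ i) * a i) ≤ 2 ^ n * Real.exp (n * c ^ 2 / 2) := by
  have h := Finset.prod_univ_sum (fun _ : Fin n => (Finset.univ : Finset Bool))
    (fun i b => Real.exp (sign b * a i))
  rw [Fintype.piFinset_univ] at h
  simp_rw [Real.exp_sum]
  rw [← h]
  calc ∏ i, ∑ b : Bool, Real.exp (sign b * a i) ≤ ∏ _i : Fin n, 2 * Real.exp (c ^ 2 / 2) := by
        refine Finset.prod_le_prod (fun i _ => by positivity) fun i _ => ?_
        have h1 : ∑ b : Bool, Real.exp (sign b * a i) = 2 * Real.cosh (a i) := by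
          rw [Real.cosh_eq]
          simp only [Fintype.sum_bool, sign, if_true, Bool.false_eq_true, if_false, one_mul, neg_mul]
          ring
        rw [h1]
        have h2 : a i ^ 2 ≤ c ^ 2 := sq_le_sq' (abs_le.1 (ha i)).1 (abs_le.1 (ha i)).2
        have := Real.cosh_le_exp_half_sq (a i)
        have h3 : Real.exp (a i ^ 2 / 2) ≤ Real.exp (c ^ 2 / 2) := by gcongr
        linarith
    _ = _ := by
        rw [Finset.prod_const, Finset.card_univ, Fintype.card_fin, mul_pow, ← Real.exp_nat_mul]
        ring_nf

theorem card_sign_sum_lt_le {n : ℕ} (a : Fin n → ℝ) {c t : ℝ} (hc : 0 < c)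
    (ha : ∀ i, |a i| ≤ c) (ht : 0 ≤ t) :
    ((Finset.univ.filter fun σ : Fin n → Bool => n * t < ∑ i, sign (σ i) * a i).card : ℝ) ≤
      2 ^ n * Real.exp (-(n * t ^ 2 / (2 * c ^ 2))) := by
  -- The Chernoff parameter that minimises the exponent `n r² c² / 2 - r n t`.
  set r := t / c ^ 2 with hr
  have hr0 : 0 ≤ r := by positivity
  have h1 := sum_exp_sign_le (fun i => r * a i) (c := r * c) (fun i => by
    rw [abs_mul, abs_of_nonneg hr0]
    exact mul_le_mul_of_nonneg_left (ha i) hr0)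
  have h2 : ((Finset.univ.filter fun σ : Fin n → Bool => n * t < ∑ i, sign (σ i) * a i).card : ℝ) *
      Real.exp (r * (n * t)) ≤ ∑ σ : Fin n → Bool, Real.exp (∑ i, sign (σ i) * (r * a i)) := by
    rw [← nsmul_eq_mul, ← Finset.sum_const]
    refine (Finset.sum_le_sum fun σ hσ => ?_).trans
      (Finset.sum_le_sum_of_subset_of_nonneg (Finset.filter_subset _ _)
        fun _ _ _ => (Real.exp_pos _).le)
    have := (Finset.mem_filter.1 hσ).2
    have e : ∑ i, sign (σ i) * (r * a i) = r * ∑ i, sign (σ i) * a i := by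
      rw [Finset.mul_sum]
      exact Finset.sum_congr rfl fun i _ => by ring
    rw [e]
    gcongr
  have h3 := h2.trans h1
  rw [← le_div_iff₀ (Real.exp_pos _), mul_div_assoc, ← Real.exp_sub] at h3
  refine h3.trans_eq ?_
  congr 2
  rw [hr]
  field_simp
  ring

/-- Hoeffding's inequality for random signs, as a count. -/
theorem card_abs_sign_sum_lt_le {n : ℕ} (a : Fin n → ℝ) {c t : ℝ} (hc : 0 < c)
    (ha : ∀ i, |a i| ≤ c) (ht : 0 ≤ t) :
    ((Finset.univ.filter fun σ : Fin n → Bool => n * t < |∑ i, sign (σ i) * a i|).card : ℝ) ≤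
      2 * (2 ^ n * Real.exp (-(n * t ^ 2 / (2 * c ^ 2)))) := by
  have h1 := card_sign_sum_lt_le a hc ha ht
  have h2 := card_sign_sum_lt_le (fun i => -a i) hc (fun i => by rw [abs_neg]; exact ha i) ht
  have h3 : (Finset.univ.filter fun σ : Fin n → Bool => n * t < |∑ i, sign (σ i) * a i|) ⊆
      (Finset.univ.filter fun σ : Fin n → Bool => n * t < ∑ i, sign (σ i) * a i) ∪
      (Finset.univ.filter fun σ : Fin n → Bool => n * t < ∑ i, sign (σ i) * -a i) := by
    intro σ hσ
    simp only [Finset.mem_union, Finset.mem_filter, Finset.mem_univ, true_and] at hσ ⊢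
    rcases lt_abs.1 hσ with h | h
    · exact Or.inl h
    · right
      simpa [mul_neg, Finset.sum_neg_distrib] using h
  have h4 : ((Finset.univ.filter fun σ : Fin n → Bool =>
      n * t < |∑ i, sign (σ i) * a i|).card : ℝ) ≤ _ :=
    Nat.cast_le.2 ((Finset.card_le_card h3).trans (Finset.card_union_le _ _))
  push_cast at h4
  linarith

end Combinatorics

/-! ### Comparison with a ghost sample, and its symmetrization. -/

section Discrepancy

variable {α : Type*}

/-- The discrepancy over the class `𝒜` between the first `n` lists of the left half of `w` and
those of the right half. -/
noncomputable def disc (𝒜 : Set (Set α)) (n : ℕ) (w : ℕ ⊕ ℕ → List α) : ℝ :=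
  ⨆ A : 𝒜, |∑ i : Fin n, ((hits (A : Set α) (w (.inl i)) : ℝ) - hits (A : Set α) (w (.inr i)))|

theorem disc_nonneg (𝒜 : Set (Set α)) (n : ℕ) (w : ℕ ⊕ ℕ → List α) : 0 ≤ disc 𝒜 n w :=
  Real.iSup_nonneg fun _ => abs_nonneg _

theorem abs_hits_sub_hits_le {L L' : List α} {M : ℕ} (h : L.length ≤ M) (h' : L'.length ≤ M)
    (A : Set α) : |(hits A L : ℝ) - hits A L'| ≤ M := by
  have h1 : (hits A L : ℝ) ≤ M := Nat.cast_le.2 ((hits_le_length A L).trans h)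
  have h2 : (hits A L' : ℝ) ≤ M := Nat.cast_le.2 ((hits_le_length A L').trans h')
  have h3 : (0 : ℝ) ≤ hits A L := Nat.cast_nonneg _
  have h4 : (0 : ℝ) ≤ hits A L' := Nat.cast_nonneg _
  rw [abs_le]
  constructor <;> linarith

theorem abs_sum_hits_le {n M : ℕ} {w : ℕ ⊕ ℕ → List α} (hw : ∀ k, (w k).length ≤ M) (A : Set α) :
    |∑ i : Fin n, ((hits A (w (.inl i)) : ℝ) - hits A (w (.inr i)))| ≤ n * M := by
  refine (Finset.abs_sum_le_sum_abs _ _).trans ?_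
  calc _ ≤ ∑ _i : Fin n, (M : ℝ) :=
        Finset.sum_le_sum fun i _ => abs_hits_sub_hits_le (hw _) (hw _) A
    _ = n * M := by simp

theorem disc_le {n M : ℕ} {w : ℕ ⊕ ℕ → List α} (hw : ∀ k, (w k).length ≤ M) (𝒜 : Set (Set α)) :
    disc 𝒜 n w ≤ n * M :=
  Real.iSup_le (fun A => abs_sum_hits_le hw A) (by positivity)

theorem abs_sum_le_disc {n M : ℕ} {w : ℕ ⊕ ℕ → List α} (hw : ∀ k, (w k).length ≤ M)
    {𝒜 : Set (Set α)} {A : Set α} (hA : A ∈ 𝒜) :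
    |∑ i : Fin n, ((hits A (w (.inl i)) : ℝ) - hits A (w (.inr i)))| ≤ disc 𝒜 n w := by
  refine le_ciSup (f := fun A : 𝒜 => |∑ i : Fin n,
    ((hits (A : Set α) (w (.inl i)) : ℝ) - hits (A : Set α) (w (.inr i)))|) ?_ ⟨A, hA⟩
  refine ⟨n * M, ?_⟩
  rintro _ ⟨B, rfl⟩
  exact abs_sum_hits_le hw B

/-- Exchange `inl i` and `inr i` for every `i` with `σ i = false`. -/
def swapIdx {n : ℕ} (σ : Fin n → Bool) : ℕ ⊕ ℕ → ℕ ⊕ ℕ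
  | .inl i => if ∃ h : i < n, σ ⟨i, h⟩ = false then .inr i else .inl i
  | .inr i => if ∃ h : i < n, σ ⟨i, h⟩ = false then .inl i else .inr i

theorem swapIdx_injective {n : ℕ} (σ : Fin n → Bool) : Function.Injective (swapIdx σ) := by
  have h : Function.Involutive (swapIdx σ) := by
    rintro (i | i) <;> by_cases hi : ∃ h : i < n, σ ⟨i, h⟩ = false <;>
      simp only [swapIdx, hi, if_true, if_false]
  exact h.injective

/-- Swapping the two `i`-th lists negates the `i`-th difference of hits, which turns swaps into
signs. -/
theorem disc_swapIdx (𝒜 : Set (Set α)) {n : ℕ} (σ : Fin n → Bool) (w : ℕ ⊕ ℕ → List α) :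
    disc 𝒜 n (fun k => w (swapIdx σ k)) = ⨆ A : 𝒜, |∑ i : Fin n, sign (σ i) *
      ((hits (A : Set α) (w (.inl i)) : ℝ) - hits (A : Set α) (w (.inr i)))| := by
  unfold disc
  congr 1
  funext A
  congr 1
  refine Finset.sum_congr rfl fun i _ => ?_
  by_cases hi : σ i = false
  · simp [swapIdx, hi, sign]
  · have h2 : ¬ ∃ h : (i : ℕ) < n, σ ⟨i, h⟩ = false := fun ⟨_, h⟩ => hi h
    simp only [swapIdx, h2, if_false, sign, if_pos (eq_true_of_ne_false hi), one_mul]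

/-- With the data fixed, the supremum involves only the traces of `𝒜` on the pooled points, so a
union bound over polynomially many representatives combines with Hoeffding's inequality for bounded
differences of hits. -/
theorem card_lt_disc_swapIdx_le {𝒜 : Set (Set α)} {d n M : ℕ} (h𝒜 : vcDim 𝒜 ≤ d) (hM0 : 0 < M)
    {w : ℕ ⊕ ℕ → List α} (hw : ∀ k, (w k).length ≤ M) {t : ℝ} (ht : 0 ≤ t) :
    (Nat.card {σ : Fin n → Bool // n * t < disc 𝒜 n (fun k => w (swapIdx σ k))} : ℝ) ≤
      2 ^ n * ((d + 1) * (2 * n * M + 1) ^ d * 2 * Real.exp (-(n * t ^ 2 / (2 * (M : ℝ) ^ 2)))) := by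
  classical
  let T : Finset α := Finset.univ.biUnion fun k : Fin n ⊕ Fin n =>
    (w (k.map Fin.val Fin.val)).toFinset
  have hT : T.card ≤ 2 * n * M := by
    refine Finset.card_biUnion_le.trans ?_
    calc _ ≤ ∑ _k : Fin n ⊕ Fin n, M :=
          Finset.sum_le_sum fun k _ => (List.toFinset_card_le _).trans (hw _)
      _ = 2 * n * M := by
          rw [Finset.sum_const, Finset.card_univ, Fintype.card_sum, Fintype.card_fin, smul_eq_mul]
          ring
  obtain ⟨ℬ, -, hcard, hrep⟩ := exists_trace_representatives h𝒜 T
  have hcong : ∀ {A B : Set α}, (∀ x ∈ T, x ∈ A ↔ x ∈ B) → ∀ k : Fin n ⊕ Fin n,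
      hits A (w (k.map Fin.val Fin.val)) = hits B (w (k.map Fin.val Fin.val)) := by
    intro A B hAB k
    refine List.countP_congr fun x hx => ?_
    have : x ∈ T := Finset.mem_biUnion.2 ⟨k, Finset.mem_univ _, List.mem_toFinset.2 hx⟩
    simpa using hAB x this
  have hsub : (Finset.univ.filter fun σ : Fin n → Bool =>
      n * t < disc 𝒜 n (fun k => w (swapIdx σ k))) ⊆
      ℬ.biUnion fun B => Finset.univ.filter fun σ : Fin n → Bool => n * t <
        |∑ i, sign (σ i) * ((hits B (w (.inl i)) : ℝ) - hits B (w (.inr i)))| := by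
    intro σ hσ
    have hlt := (Finset.mem_filter.1 hσ).2
    rw [disc_swapIdx] at hlt
    -- For an empty class the real supremum is `0` by convention and cannot exceed the threshold.
    rcases isEmpty_or_nonempty 𝒜 with hE | hN
    · rw [Real.iSup_of_isEmpty] at hlt
      exact absurd hlt (not_lt.2 (by positivity))
    · obtain ⟨A, hA⟩ := exists_lt_of_lt_ciSup hlt
      obtain ⟨B, hB, hAB⟩ := hrep A A.2
      refine Finset.mem_biUnion.2 ⟨B, hB, Finset.mem_filter.2 ⟨Finset.mem_univ _, ?_⟩⟩
      have hl : ∀ i : Fin n, hits A.1 (w (.inl i)) = hits B (w (.inl i)) :=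
        fun i => hcong hAB (.inl i)
      have hr : ∀ i : Fin n, hits A.1 (w (.inr i)) = hits B (w (.inr i)) :=
        fun i => hcong hAB (.inr i)
      simpa only [hl, hr] using hA
  have h1 : Nat.card {σ : Fin n → Bool // n * t < disc 𝒜 n (fun k => w (swapIdx σ k))} =
      (Finset.univ.filter fun σ : Fin n → Bool =>
        n * t < disc 𝒜 n (fun k => w (swapIdx σ k))).card := by
    rw [Nat.card_eq_fintype_card, Fintype.card_subtype]
  rw [h1]
  have h2 : ((Finset.univ.filter fun σ : Fin n → Bool =>
      n * t < disc 𝒜 n (fun k => w (swapIdx σ k))).card : ℝ) ≤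
      ∑ B ∈ ℬ, ((Finset.univ.filter fun σ : Fin n → Bool => n * t <
        |∑ i, sign (σ i) * ((hits B (w (.inl i)) : ℝ) - hits B (w (.inr i)))|).card : ℝ) := by
    exact_mod_cast (Finset.card_le_card hsub).trans Finset.card_biUnion_le
  have h3 : (ℬ.card : ℝ) ≤ (d + 1) * (2 * n * M + 1) ^ d := by
    have : (ℬ.card : ℝ) ≤ ((d + 1) * (2 * n * M + 1) ^ d : ℕ) := by
      exact_mod_cast hcard.trans (by gcongr)
    exact_mod_cast this
  calc _ ≤ _ := h2
    _ ≤ ∑ _B ∈ ℬ, 2 * (2 ^ n * Real.exp (-(n * t ^ 2 / (2 * (M : ℝ) ^ 2)))) :=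
        Finset.sum_le_sum fun B _ => card_abs_sign_sum_lt_le _ (by exact_mod_cast hM0)
          (fun i => abs_hits_sub_hits_le (hw _) (hw _) B) ht
    _ = ℬ.card * (2 * (2 ^ n * Real.exp (-(n * t ^ 2 / (2 * (M : ℝ) ^ 2))))) := by simp
    _ ≤ (d + 1) * (2 * n * M + 1) ^ d *
        (2 * (2 ^ n * Real.exp (-(n * t ^ 2 / (2 * (M : ℝ) ^ 2))))) := by gcongr
    _ = _ := by ring

theorem hits_eq_sum_getD (A : Set α) (L : List α) (x₀ : α) :
    (hits A L : ℝ) = ∑ p : Fin L.length, A.indicator (fun _ => (1 : ℝ)) (L.getD p x₀) := by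
  induction L with
  | nil => simp [hits]
  | cons x L ih =>
    change _ = ∑ p : Fin (L.length + 1), A.indicator (fun _ => (1 : ℝ)) ((x :: L).getD p x₀)
    rw [Fin.sum_univ_succ]
    simp only [List.getD_cons_succ, Fin.val_succ, ← ih]
    by_cases h : x ∈ A <;> simp [hits, h, add_comm]

end Discrepancy

/-! ### Measurability of the discrepancy. -/

section Measurability

variable {α : Type*} [MeasurableSpace α]

theorem measurable_getD (p : ℕ) (x₀ : α) : Measurable fun L : List α => L.getD p x₀ := by
  refine measurable_from_list fun n => ?_
  by_cases h : p < n
  · have e : (fun v : Fin n → α => (List.ofFn v).getD p x₀) = fun v => v ⟨p, h⟩ := by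
      funext v
      simp [List.getD, h]
    rw [e]
    exact measurable_pi_apply _
  · have e : (fun v : Fin n → α => (List.ofFn v).getD p x₀) = fun _ => x₀ := by
      funext v
      simp [List.getD, h]
    rw [e]
    exact measurable_const

/-- Once all list lengths are prescribed, the discrepancy is a signed empirical supremum in a fixed
number of points, to which `IsMeasurableClass` applies. There are countably many length profiles. -/
theorem aemeasurable_disc [Nonempty α] {𝒜 : Set (Set α)} (h𝒜 : IsMeasurableClass 𝒜) (n : ℕ)
    (η : Measure (ℕ ⊕ ℕ → List α)) [IsProbabilityMeasure η] : AEMeasurable (disc 𝒜 n) η := by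
  obtain ⟨x₀⟩ := ‹Nonempty α›
  let V (ℓ : Fin n ⊕ Fin n → ℕ) : Set (ℕ ⊕ ℕ → List α) :=
    {w | ∀ k, (w (k.map Fin.val Fin.val)).length = ℓ k}
  have hV : ∀ ℓ, MeasurableSet (V ℓ) := by
    intro ℓ
    simp only [V, Set.ofPred_forall]
    exact MeasurableSet.iInter fun k =>
      (measurable_length.comp (measurable_pi_apply _)) (measurableSet_singleton (ℓ k))
  have hcover : ⋃ ℓ, V ℓ = Set.univ := Set.eq_univ_of_forall fun w =>
    Set.mem_iUnion.2 ⟨fun k => (w (k.map Fin.val Fin.val)).length, fun _ => rfl⟩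
  rw [← Measure.restrict_univ (μ := η), ← hcover, aemeasurable_iUnion_iff]
  intro ℓ
  let K := Σ k : Fin n ⊕ Fin n, Fin (ℓ k)
  let e : Fin (Fintype.card K) ≃ K := (Fintype.equivFin K).symm
  let c : (ℕ ⊕ ℕ → List α) → (Fin (Fintype.card K) → α) := fun w j =>
    (w ((e j).1.map Fin.val Fin.val)).getD (e j).2 x₀
  have hc : Measurable c := measurable_pi_iff.2 fun j =>
    (measurable_getD _ x₀).comp (measurable_pi_apply _)
  let ε (k : Fin n ⊕ Fin n) : ℝ := k.elim (fun _ => 1) fun _ => -1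
  have hε : ∀ j, ε (e j).1 = 1 ∨ ε (e j).1 = -1 := by
    intro j
    rcases (e j).1 with i | i <;> simp [ε]
  -- Universal measurability is used at the law of the flattened tuple of points.
  have hsup := h𝒜 _ (fun j => ε (e j).1) hε (η.map c)
    (Measure.isProbabilityMeasure_map hc.aemeasurable)
  refine ((hsup.comp_aemeasurable hc.aemeasurable).mono_measure Measure.restrict_le_self).congr ?_
  filter_upwards [ae_restrict_mem (hV ℓ)] with w hw
  simp only [Function.comp_apply, disc]
  congr 1
  funext A
  congr 1
  rw [e.sum_comp (fun q : K => ε q.1 * (A : Set α).indicator (fun _ => (1 : ℝ))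
    ((w (q.1.map Fin.val Fin.val)).getD q.2 x₀)), Fintype.sum_sigma]
  have h1 : ∀ k : Fin n ⊕ Fin n, ∑ p : Fin (ℓ k), ε k * (A : Set α).indicator (fun _ => (1 : ℝ))
      ((w (k.map Fin.val Fin.val)).getD p x₀) =
      ε k * hits (A : Set α) (w (k.map Fin.val Fin.val)) := by
    intro k
    rw [← Finset.mul_sum, hits_eq_sum_getD _ _ x₀, ← hw k]
  simp_rw [h1, Fintype.sum_sum_type, Finset.sum_sub_distrib]
  simp [ε, sub_eq_add_neg]

end Measurability

/-! ### The uniform law of large numbers for Vapnik–Chervonenkis classes. -/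

section UniformLaw

/-- Sample and ghost sample together form one i.i.d. family, so swaps become permutations of its
index set. -/
theorem map_sumElim_infinitePi {β : Type*} [MeasurableSpace β] (ν : Measure β)
    [IsProbabilityMeasure ν] :
    ((Measure.infinitePi fun _ : ℕ => ν).prod (Measure.infinitePi fun _ : ℕ => ν)).map
      (fun p => (Sum.elim p.1 p.2 : ℕ ⊕ ℕ → β)) = Measure.infinitePi fun _ : ℕ ⊕ ℕ => ν := by
  have hm : Measurable fun p : (ℕ → β) × (ℕ → β) => (Sum.elim p.1 p.2 : ℕ ⊕ ℕ → β) := by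
    refine measurable_pi_iff.2 fun k => ?_
    rcases k with i | i
    · exact (measurable_pi_apply i).comp measurable_fst
    · exact (measurable_pi_apply i).comp measurable_snd
  refine Measure.eq_infinitePi _ fun s t ht => ?_
  rw [Measure.map_apply hm (MeasurableSet.pi s.countable_toSet fun k _ => ht k)]
  have e : (fun p : (ℕ → β) × (ℕ → β) => (Sum.elim p.1 p.2 : ℕ ⊕ ℕ → β)) ⁻¹' (Set.pi s t) =
      (Set.pi s.toLeft fun i => t (.inl i)) ×ˢ (Set.pi s.toRight fun i => t (.inr i)) := by
    ext p
    simp [Set.mem_pi]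
  rw [e, Measure.prod_prod, Measure.infinitePi_pi _ (fun i _ => ht _),
    Measure.infinitePi_pi _ (fun i _ => ht _)]
  conv_rhs => rw [← Finset.toLeft_disjSum_toRight (u := s), Finset.prod_disjSum]

variable {α : Type*} [MeasurableSpace α]

theorem ae_forall_length_le {ι : Type*} [Countable ι] {ν : Measure (List α)}
    [IsProbabilityMeasure ν] {M : ℕ} (hM : ∀ᵐ L ∂ν, L.length ≤ M) :
    ∀ᵐ w ∂Measure.infinitePi (fun _ : ι => ν), ∀ k, (w k).length ≤ M :=
  ae_all_iff.2 fun k =>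
    (measurePreserving_eval_infinitePi (fun _ : ι => ν) k).quasiMeasurePreserving.ae hM

/-- All `2 ^ n` swaps give the event the same probability. Averaging over them under the integral
reduces the claim to counting sign patterns for fixed data. -/
theorem measure_lt_disc_le [Nonempty α] {𝒜 : Set (Set α)} (hmeas : IsMeasurableClass 𝒜) {d M : ℕ}
    (h𝒜 : vcDim 𝒜 ≤ d) (hM0 : 0 < M) {ν : Measure (List α)} [IsProbabilityMeasure ν]
    (hM : ∀ᵐ L ∂ν, L.length ≤ M) {t : ℝ} (ht : 0 ≤ t) (n : ℕ) :
    Measure.infinitePi (fun _ : ℕ ⊕ ℕ => ν) {w | n * t < disc 𝒜 n w} ≤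
      ENNReal.ofReal ((d + 1) * (2 * n * M + 1) ^ d * 2 *
        Real.exp (-(n * t ^ 2 / (2 * (M : ℝ) ^ 2)))) := by
  classical
  set Q := Measure.infinitePi (fun _ : ℕ ⊕ ℕ => ν)
  set C := (d + 1) * (2 * n * M + 1) ^ d * 2 * Real.exp (-(n * t ^ 2 / (2 * (M : ℝ) ^ 2)))
  have hE : NullMeasurableSet {w | n * t < disc 𝒜 n w} Q :=
    nullMeasurableSet_lt aemeasurable_const (aemeasurable_disc hmeas n Q)
  have hmp : ∀ σ : Fin n → Bool, MeasurePreserving (fun w k => w (swapIdx σ k)) Q Q := fun σ =>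
    ⟨measurable_pi_iff.2 fun k => measurable_pi_apply _,
      Measure.map_infinitePi_infinitePi_of_inj (P := fun _ => ν) (swapIdx_injective σ)⟩
  let E (σ : Fin n → Bool) : Set (ℕ ⊕ ℕ → List α) :=
    {w | n * t < disc 𝒜 n fun k => w (swapIdx σ k)}
  have hEσ : ∀ σ, NullMeasurableSet (E σ) Q := fun σ =>
    hE.preimage (hmp σ).quasiMeasurePreserving
  have h1 : ∀ σ, ∫⁻ w, (E σ).indicator (fun _ => (1 : ℝ≥0∞)) w ∂Q = Q {w | n * t < disc 𝒜 n w} := fun σ => by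
    rw [lintegral_indicator_const₀ (hEσ σ), one_mul]
    exact (hmp σ).measure_preimage hE
  have h2 : ∑ σ : Fin n → Bool, ∫⁻ w, (E σ).indicator (fun _ => (1 : ℝ≥0∞)) w ∂Q =
      2 ^ n * Q {w | n * t < disc 𝒜 n w} := by
    simp [h1]
  have h3 : ∫⁻ w, ∑ σ : Fin n → Bool, (E σ).indicator (fun _ => (1 : ℝ≥0∞)) w ∂Q ≤ ENNReal.ofReal (2 ^ n * C) := by
    calc _ ≤ ∫⁻ _w, ENNReal.ofReal (2 ^ n * C) ∂Q := by
          refine lintegral_mono_ae ?_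
          filter_upwards [ae_forall_length_le hM] with w hw
          have h4 := card_lt_disc_swapIdx_le (n := n) h𝒜 hM0 hw ht
          have h5 : ∑ σ : Fin n → Bool, (E σ).indicator (fun _ => (1 : ℝ≥0∞)) w = ENNReal.ofReal
              (Nat.card {σ : Fin n → Bool // n * t < disc 𝒜 n (fun k => w (swapIdx σ k))} : ℝ) := by
            rw [ENNReal.ofReal_natCast, Nat.card_eq_fintype_card, Fintype.card_subtype,
              Finset.card_filter]
            push_cast
            refine Finset.sum_congr rfl fun σ _ => ?_
            simp [E, Set.indicator_apply]
          rw [h5]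
          exact ENNReal.ofReal_le_ofReal h4
      _ = _ := by simp
  rw [lintegral_finsetSum' _ fun σ _ => (aemeasurable_const (b := (1 : ℝ≥0∞))).indicator₀ (hEσ σ), h2,
    ENNReal.ofReal_mul (by positivity), ENNReal.ofReal_pow (by norm_num)] at h3
  have h6 : ENNReal.ofReal 2 ^ n = 2 ^ n := by simp
  rw [h6] at h3
  exact (ENNReal.mul_le_mul_iff_right (by simp) (by simp)).1 h3

theorem summable_poly_mul_exp (d M : ℕ) {r : ℝ} (hr : 0 < r) :
    Summable fun n : ℕ => ((d : ℝ) + 1) * (2 * n * M + 1) ^ d * 2 * Real.exp (-(n * r)) := by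
  have h := (Real.summable_pow_mul_exp_neg_nat_mul d hr)
  -- Dropping the term `n = 0` makes `2 n M + 1 ≤ (2 M + 1) n` available.
  rw [← summable_nat_add_iff 1] at h ⊢
  refine Summable.of_nonneg_of_le (fun n => by positivity) (fun n => ?_)
    (h.mul_left (((d : ℝ) + 1) * (2 * (M : ℝ) + 1) ^ d * 2))
  have h1 : (2 * ((n + 1 : ℕ) : ℝ) * M + 1) ^ d ≤ (2 * M + 1) ^ d * ((n + 1 : ℕ) : ℝ) ^ d := by
    rw [← mul_pow]
    refine pow_le_pow_left₀ (by positivity) ?_ d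
    push_cast
    nlinarith [(Nat.cast_nonneg n : (0 : ℝ) ≤ n)]
  calc _ ≤ ((d : ℝ) + 1) * ((2 * M + 1) ^ d * ((n + 1 : ℕ) : ℝ) ^ d) * 2 *
        Real.exp (-(((n + 1 : ℕ) : ℝ) * r)) := by gcongr
    _ = _ := by
      rw [show -(((n + 1 : ℕ) : ℝ) * r) = -r * ((n + 1 : ℕ) : ℝ) by ring]
      ring

/-- Borel–Cantelli at each of the countably many thresholds `1 / (j + 1)`. -/
theorem ae_tendsto_disc [Nonempty α] {𝒜 : Set (Set α)} (hmeas : IsMeasurableClass 𝒜)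
    (h𝒜 : vcDim 𝒜 < ⊤) {M : ℕ} (hM0 : 0 < M) {ν : Measure (List α)} [IsProbabilityMeasure ν]
    (hM : ∀ᵐ L ∂ν, L.length ≤ M) :
    ∀ᵐ w ∂Measure.infinitePi (fun _ : ℕ ⊕ ℕ => ν),
      Tendsto (fun n : ℕ => disc 𝒜 n w / n) atTop (𝓝 0) := by
  obtain ⟨d, hd⟩ := ENat.ne_top_iff_exists.1 h𝒜.ne
  have key : ∀ j : ℕ, ∀ᵐ w ∂Measure.infinitePi (fun _ : ℕ ⊕ ℕ => ν), ∀ᶠ n : ℕ in atTop,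
      disc 𝒜 n w ≤ n * (1 / ((j : ℝ) + 1)) := by
    intro j
    have ht : (0 : ℝ) < 1 / ((j : ℝ) + 1) := by positivity
    have hs := summable_poly_mul_exp d M (r := (1 / ((j : ℝ) + 1)) ^ 2 / (2 * (M : ℝ) ^ 2))
      (by positivity)
    have hsum : ∑' n : ℕ, Measure.infinitePi (fun _ : ℕ ⊕ ℕ => ν)
        {w | n * (1 / ((j : ℝ) + 1)) < disc 𝒜 n w} ≠ ∞ := by
      refine ne_top_of_le_ne_top hs.tsum_ofReal_ne_top (ENNReal.tsum_le_tsum fun n => ?_)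
      refine (measure_lt_disc_le hmeas hd.ge hM0 hM ht.le n).trans_eq ?_
      rw [mul_div_assoc]
    filter_upwards [ae_eventually_notMem hsum] with w hw
    filter_upwards [hw] with n hn
    simpa using hn
  filter_upwards [ae_all_iff.2 key] with w hw
  rw [Metric.tendsto_atTop']
  intro ε hε
  obtain ⟨j, hj⟩ := exists_nat_one_div_lt hε
  obtain ⟨N, hN⟩ := eventually_atTop.1 (hw j)
  refine ⟨N, fun n hn => ?_⟩
  have hn0 : (0 : ℝ) < n := by exact_mod_cast (Nat.zero_le N).trans_lt hn
  rw [Real.dist_eq, sub_zero, abs_of_nonneg (div_nonneg (disc_nonneg _ _ _) hn0.le)]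
  refine lt_of_le_of_lt ?_ hj
  rw [div_le_iff₀ hn0, mul_comm]
  exact hN n hn.le

/-- The uniform law of large numbers for the numbers of hits of the sets of a
Vapnik–Chervonenkis class by independent random lists of bounded length. -/
theorem ae_exists_uniform_bound [Nonempty α] {𝒜 : Set (Set α)} (hmeas : IsMeasurableClass 𝒜)
    (h𝒜 : vcDim 𝒜 < ⊤) (hborel : ∀ A ∈ 𝒜, MeasurableSet A) {M : ℕ} (hM0 : 0 < M)
    {ν : Measure (List α)} [IsProbabilityMeasure ν] (hM : ∀ᵐ L ∂ν, L.length ≤ M) :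
    ∀ᵐ y ∂Measure.infinitePi (fun _ : ℕ => ν), ∃ b : ℕ → ℝ, Tendsto b atTop (𝓝 0) ∧
      ∀ n, 0 < n → ∀ A ∈ 𝒜,
        |(∑ i ∈ Finset.range n, (hits A (y i) : ℝ)) / n - ∫ L, (hits A L : ℝ) ∂ν| ≤ b n := by
  set ρ := Measure.infinitePi (fun _ : ℕ => ν)
  have hmJ : Measurable fun p : (ℕ → List α) × (ℕ → List α) =>
      (Sum.elim p.1 p.2 : ℕ ⊕ ℕ → List α) := by
    refine measurable_pi_iff.2 fun k => ?_
    rcases k with i | i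
    · exact (measurable_pi_apply i).comp measurable_fst
    · exact (measurable_pi_apply i).comp measurable_snd
  have hJ := map_sumElim_infinitePi ν
  have h1 : ∀ᵐ y ∂ρ, ∀ᵐ y' ∂ρ,
      Tendsto (fun n : ℕ => disc 𝒜 n (Sum.elim y y') / n) atTop (𝓝 0) := by
    refine Measure.ae_ae_of_ae_prod (p := fun p : (ℕ → List α) × (ℕ → List α) =>
      Tendsto (fun n : ℕ => disc 𝒜 n (Sum.elim p.1 p.2) / n) atTop (𝓝 0)) ?_
    refine ae_of_ae_map hmJ.aemeasurable (p := fun w =>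
      Tendsto (fun n : ℕ => disc 𝒜 n w / n) atTop (𝓝 0)) ?_
    rw [hJ]
    exact ae_tendsto_disc hmeas h𝒜 hM0 hM
  have h2 : ∀ᵐ y ∂ρ, ∀ n, AEMeasurable (fun y' => disc 𝒜 n (Sum.elim y y')) ρ := by
    refine ae_all_iff.2 fun n => ?_
    -- Almost-everywhere measurability in the pair of samples descends to almost every section.
    have h := (hJ ▸ aemeasurable_disc hmeas n (Measure.infinitePi fun _ : ℕ ⊕ ℕ => ν) :
      AEMeasurable (disc 𝒜 n) ((ρ.prod ρ).map fun p => (Sum.elim p.1 p.2 : ℕ ⊕ ℕ → List α)))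
    have h' : AEMeasurable (fun p : (ℕ → List α) × (ℕ → List α) => disc 𝒜 n (Sum.elim p.1 p.2))
        (ρ.prod ρ) := h.comp_aemeasurable hmJ.aemeasurable
    filter_upwards [h'.aestronglyMeasurable.prodMk_left] with y hy
    exact hy.aemeasurable
  have h3 := ae_forall_length_le (ι := ℕ) hM
  filter_upwards [h1, h2, h3] with y hy1 hy2 hy3
  have hlen : ∀ᵐ y' ∂ρ, ∀ k, ((Sum.elim y y' : ℕ ⊕ ℕ → List α) k).length ≤ M := by
    filter_upwards [h3] with y' hy' k
    rcases k with i | i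
    · exact hy3 i
    · exact hy' i
  have hbd : ∀ n : ℕ, ∀ᵐ y' ∂ρ, ‖disc 𝒜 n (Sum.elim y y') / n‖ ≤ M := by
    intro n
    filter_upwards [hlen] with y' hy'
    rw [Real.norm_of_nonneg (div_nonneg (disc_nonneg _ _ _) (Nat.cast_nonneg n))]
    refine div_le_of_le_mul₀ (by positivity) (by positivity) ?_
    rw [mul_comm]
    exact disc_le hy' 𝒜
  have haes : ∀ n : ℕ, AEStronglyMeasurable (fun y' => disc 𝒜 n (Sum.elim y y') / n) ρ :=
    fun n => ((hy2 n).div_const _).aestronglyMeasurable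
  -- The bound is the mean discrepancy over the ghost sample. It tends to zero by dominated
  -- convergence, as `disc / n ≤ M`.
  refine ⟨fun n => ∫ y', disc 𝒜 n (Sum.elim y y') / n ∂ρ, ?_, fun n hn A hA => ?_⟩
  · have h := tendsto_integral_of_dominated_convergence (μ := ρ)
      (F := fun (n : ℕ) y' => disc 𝒜 n (Sum.elim y y') / n) (f := fun _ => 0) (fun _ => (M : ℝ))
      haes (integrable_const _) hbd hy1
    simpa using h
  · have hn0 : (0 : ℝ) < n := by exact_mod_cast hn
    have hev : ∀ i, MeasurePreserving (Function.eval i) ρ ν :=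
      fun i => measurePreserving_eval_infinitePi (fun _ : ℕ => ν) i
    have hint : ∀ i : ℕ, Integrable (fun y' : ℕ → List α => (hits A (y' i) : ℝ)) ρ := fun i =>
      (hev i).integrable_comp_of_integrable (integrable_hits hM (hborel A hA))
    have hval : ∀ i : ℕ, ∫ y', (hits A (y' i) : ℝ) ∂ρ = ∫ L, (hits A L : ℝ) ∂ν := fun i => by
      conv_rhs => rw [← (hev i).map_eq]
      rw [integral_map (hev i).measurable.aemeasurable
        (measurable_hits_real (hborel A hA)).aestronglyMeasurable]
    -- Integrating out the ghost sample turns its average into the exact mean; the absolute value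
    -- then moves inside the integral.
    have e : ∫ y', (∑ i : Fin n, ((hits A (y i) : ℝ) - hits A (y' i))) / n ∂ρ =
        (∑ i ∈ Finset.range n, (hits A (y i) : ℝ)) / n - ∫ L, (hits A L : ℝ) ∂ν := by
      have hdiff : ∀ i : Fin n, Integrable (fun y' : ℕ → List α =>
          (hits A (y i) : ℝ) - hits A (y' i)) ρ := fun i => (integrable_const _).sub (hint i)
      rw [integral_div, integral_finsetSum _ fun i _ => hdiff i]
      simp_rw [integral_sub (integrable_const _) (hint _), hval]
      rw [Finset.sum_range, Finset.sum_sub_distrib]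
      simp only [integral_const, probReal_univ, smul_eq_mul, one_mul, Finset.sum_const,
        Finset.card_univ, Fintype.card_fin, nsmul_eq_mul]
      field_simp
    rw [← e]
    refine (abs_integral_le_integral_abs).trans
      (integral_mono_of_nonneg (ae_of_all _ fun _ => abs_nonneg _)
        (Integrable.of_bound (haes n) M (hbd n)) ?_)
    filter_upwards [hlen] with y' hy'
    rw [abs_div, abs_of_pos hn0]
    exact div_le_div_of_nonneg_right (abs_sum_le_disc hy' hA) hn0.le

end UniformLaw

/-! ### Finite brackets for the convex sets. -/

section ConvexBrackets

open TopologicalSpace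

/-- Convexity says that `a K + b K` is absorbed by `K` for all weights, and each such condition
equates two continuous functions of `K`. -/
theorem isClosed_convex_nonemptyCompacts {E : Type*} [NormedAddCommGroup E] [NormedSpace ℝ E] :
    IsClosed {K : NonemptyCompacts E | Convex ℝ (K : Set E)} := by
  have hf : ∀ a b : ℝ, Continuous fun p : E × E => a • p.1 + b • p.2 := fun a b => by fun_prop
  have e : {K : NonemptyCompacts E | Convex ℝ (K : Set E)} =
      ⋂ (a : ℝ) (b : ℝ) (_ : 0 ≤ a) (_ : 0 ≤ b) (_ : a + b = 1),
        {K : NonemptyCompacts E | (K ×ˢ K).map _ (hf a b) ⊔ K = K} := by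
    ext K
    simp only [Set.mem_ofPred_eq, Set.mem_iInter, sup_eq_right]
    constructor
    · intro hK a b ha hb hab
      rintro _ ⟨⟨x, y⟩, ⟨hx, hy⟩, rfl⟩
      exact hK hx hy ha hb hab
    · intro h x hx y hy a b ha hb hab
      exact h a b ha hb hab ⟨(x, y), ⟨hx, hy⟩, rfl⟩
  rw [e]
  refine isClosed_iInter fun a => isClosed_iInter fun b => isClosed_iInter fun _ =>
    isClosed_iInter fun _ => isClosed_iInter fun _ => isClosed_eq ?_ continuous_id
  exact (((hf a b).nonemptyCompacts_map).comp
    (NonemptyCompacts.continuous_prod.comp (continuous_id.prodMk continuous_id))).sup continuous_id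

/-- In finite dimension affine spans are closed, so a convex set whose closure has interior points
has some itself, and then both interiors agree. This handles convex sets that are not closed. -/
theorem interior_closure_subset_of_convex {E : Type*} [NormedAddCommGroup E] [NormedSpace ℝ E]
    [FiniteDimensional ℝ E] {A : Set E} (hA : Convex ℝ A) : interior (closure A) ⊆ A := by
  rcases (interior (closure A)).eq_empty_or_nonempty with h | h
  · simp [h]
  · have h1 := hA.closure.interior_nonempty_iff_affineSpan_eq_top.1 h
    have h2 : affineSpan ℝ A = ⊤ := by
      rw [eq_top_iff, ← h1]
      refine affineSpan_le.2 (closure_minimal (subset_affineSpan ℝ A) ?_)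
      exact (affineSpan ℝ A).closed_of_finiteDimensional
    rw [hA.interior_closure_eq_interior_of_nonempty_interior
      (hA.interior_nonempty_iff_affineSpan_eq_top.2 h2)]
    exact interior_subset

variable {E : Type*} [NormedAddCommGroup E] [InnerProductSpace ℝ E]

/-- If every point of the ball of radius `δ` about `x` is within less than `δ` of the closed convex
set `L`, then `x ∈ L`. -/
theorem mem_of_closedBall_near {L : Set E} (hLc : Convex ℝ L) (hLcl : IsComplete L)
    (hLn : L.Nonempty) {x : E} {δ : ℝ} (hδ : 0 ≤ δ)
    (h : ∀ z ∈ Metric.closedBall x δ, ∃ y ∈ L, dist z y ≤ δ) : x ∈ L := by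
  by_contra hx
  obtain ⟨p, hp, hmin⟩ := exists_norm_eq_iInf_of_complete_convex hLn hLcl hLc x
  have hin := (norm_eq_iInf_iff_real_inner_le_zero hLc hp).1 hmin
  have hr : 0 < ‖x - p‖ := norm_pos_iff.2 (sub_ne_zero.2 fun h => hx (h ▸ hp))
  set v := (‖x - p‖)⁻¹ • (x - p) with hv
  have hv1 : ‖v‖ = 1 := by rw [hv, norm_smul, norm_inv, norm_norm, inv_mul_cancel₀ hr.ne']
  -- The point of the ball farthest from `L` along the normal at the projection `p`; its distance to
  -- `L` would be at least `‖x - p‖ + δ`.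
  obtain ⟨y, hy, hyd⟩ := h (x + δ • v) (by
    simp [norm_smul, hv1, abs_of_nonneg hδ])
  have h1 : inner ℝ (x + δ • v - y) v ≤ δ := by
    calc inner ℝ (x + δ • v - y) v ≤ ‖x + δ • v - y‖ * ‖v‖ := real_inner_le_norm _ _
      _ ≤ δ := by rwa [hv1, mul_one, ← dist_eq_norm]
  have h2 : inner ℝ (x - p) v = ‖x - p‖ := by
    rw [hv, real_inner_smul_right, real_inner_self_eq_norm_sq]
    field_simp
  have h3 : inner ℝ (y - p) v ≤ 0 := by
    rw [hv, real_inner_smul_right, real_inner_comm]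
    exact mul_nonpos_of_nonneg_of_nonpos (by positivity) (hin y hy)
  have h4 : x + δ • v - y = (x - p) + δ • v - (y - p) := by abel
  rw [h4, inner_sub_left, inner_add_left, h2, real_inner_smul_left, real_inner_self_eq_norm_sq,
    hv1] at h1
  linarith

variable [FiniteDimensional ℝ E] [MeasurableSpace E] [BorelSpace E]

/-- Around a compact convex set there is one bracket that works for all convex sets whose closure is
close enough in the Hausdorff distance. -/
theorem exists_local_bracket (Q : Measure E) [IsFiniteMeasure Q]
    (hQ : ∀ A : Set E, Convex ℝ A → Q (frontier A) = 0) {ε : ℝ≥0∞} (hε : ε ≠ 0)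
    (K : NonemptyCompacts E) (hK : Convex ℝ (K : Set E)) :
    ∃ C U : Set E, MeasurableSet C ∧ MeasurableSet U ∧ Q U ≤ Q C + (ε + ε) ∧ ∃ δ > 0,
      ∀ L : NonemptyCompacts E, Convex ℝ (L : Set E) → dist L K < δ →
        C ⊆ interior (L : Set E) ∧ (L : Set E) ⊆ U := by
  obtain ⟨C, hCK, hC, hQC⟩ := isOpen_interior.measurableSet.exists_isCompact_sdiff_lt
    (μ := Q) (A := interior (K : Set E)) (measure_ne_top _ _) hε
  obtain ⟨U, hKU, hU, hQU⟩ := K.isCompact.exists_isOpen_lt_add (μ := Q) hε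
  obtain ⟨δ₁, hδ₁, hδ₁C⟩ := hC.exists_cthickening_subset_open isOpen_interior hCK
  obtain ⟨δ₂, hδ₂, hδ₂U⟩ := K.isCompact.exists_thickening_subset_open hU hKU
  -- The margin `δ₁` around `C` is split in two: one half for a ball inside `L`, the other for the
  -- Hausdorff error.
  refine ⟨C, U, hC.measurableSet, hU.measurableSet, ?_, min (δ₁ / 2) δ₂,
    lt_min (half_pos hδ₁) hδ₂, fun L hL hLK => ⟨fun x hx => ?_, ?_⟩⟩
  -- The null boundary lets an inner approximation of the interior be compared with an outer
  -- approximation of `K`.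
  · have h1 : Q (interior (K : Set E)) = Q K :=
      measure_eq_measure_of_null_sdiff interior_subset
        (measure_mono_null (Set.sdiff_subset_sdiff_left subset_closure) (hQ K hK))
    have h2 : Q (interior (K : Set E)) ≤ Q C + ε := by
      calc Q (interior (K : Set E)) ≤ Q (C ∪ (interior (K : Set E) \ C)) :=
            measure_mono (by rw [Set.union_sdiff_self]; exact Set.subset_union_right)
        _ ≤ Q C + Q (interior (K : Set E) \ C) := measure_union_le _ _
        _ ≤ Q C + ε := by gcongr
    calc Q U ≤ Q K + ε := hQU.le
      _ ≤ Q C + ε + ε := by rw [← h1]; gcongr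
      _ = _ := add_assoc _ _ _
  · have hfin : Metric.hausdorffEDist (L : Set E) K ≠ ∞ :=
      Metric.hausdorffEDist_ne_top_of_nonempty_of_bounded L.nonempty K.nonempty
        L.isCompact.isBounded K.isCompact.isBounded
    rw [Metric.NonemptyCompacts.dist_eq] at hLK
    refine mem_interior.2 ⟨Metric.ball x (δ₁ / 2), fun x' hx' => ?_, Metric.isOpen_ball,
      Metric.mem_ball_self (half_pos hδ₁)⟩
    refine mem_of_closedBall_near hL L.isCompact.isComplete L.nonempty (half_pos hδ₁).le
      fun z hz => ?_
    have hzK : z ∈ (K : Set E) := by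
      refine interior_subset (hδ₁C (Metric.mem_cthickening_of_dist_le z x δ₁ C hx ?_))
      have h1 := Metric.mem_closedBall.1 hz
      have h2 := Metric.mem_ball.1 hx'
      linarith [dist_triangle z x' x]
    obtain ⟨y, hy, hzy⟩ := Metric.exists_dist_lt_of_hausdorffDist_lt' hzK
      (hLK.trans_le (min_le_left _ _)) hfin
    exact ⟨y, hy, by rw [dist_comm]; exact hzy.le⟩
  · intro y hy
    have hfin : Metric.hausdorffEDist (L : Set E) K ≠ ∞ :=
      Metric.hausdorffEDist_ne_top_of_nonempty_of_bounded L.nonempty K.nonempty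
        L.isCompact.isBounded K.isCompact.isBounded
    rw [Metric.NonemptyCompacts.dist_eq] at hLK
    obtain ⟨z, hz, hyz⟩ := Metric.exists_dist_lt_of_hausdorffDist_lt hy
      (hLK.trans_le (min_le_right _ _)) hfin
    exact hδ₂U (Metric.mem_thickening_iff.2 ⟨z, hz, hyz⟩)

/-- The convex sets have finite bracketing numbers with respect to a finite measure that does not
charge their boundaries. -/
theorem exists_finite_brackets (Q : Measure E) [IsFiniteMeasure Q]
    (hQ : ∀ A : Set E, Convex ℝ A → Q (frontier A) = 0) {ε : ℝ≥0∞} (hε : ε ≠ 0) :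
    ∃ ℱ : Set (Set E × Set E), ℱ.Finite ∧
      (∀ p ∈ ℱ, MeasurableSet p.1 ∧ MeasurableSet p.2 ∧ Q p.2 ≤ Q p.1 + (ε + ε + ε)) ∧
      ∀ A : Set E, Convex ℝ A → ∃ p ∈ ℱ, p.1 ⊆ A ∧ A ⊆ p.2 := by
  obtain ⟨K₀, -, hK₀, hQK₀⟩ := MeasurableSet.univ.exists_isCompact_sdiff_lt
    (μ := Q) (measure_ne_top _ _) hε
  obtain ⟨R, hR⟩ := hK₀.isBounded.subset_closedBall 0
  set B := Metric.closedBall (0 : E) R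
  have hB : IsCompact B := isCompact_closedBall 0 R
  have hQB : Q Bᶜ ≤ ε := by
    refine (measure_mono ?_).trans hQK₀.le
    rw [← Set.compl_eq_univ_sdiff]
    exact Set.compl_subset_compl.2 hR
  have hcomp : IsCompact ({K : NonemptyCompacts E | Convex ℝ (K : Set E)} ∩
      {K : NonemptyCompacts E | (K : Set E) ⊆ B}) :=
    (NonemptyCompacts.isCompact_subsets_of_isCompact hB).inter_left isClosed_convex_nonemptyCompacts
  choose! C U hC hU hCU δ hδ hloc using fun K => exists_local_bracket Q hQ hε K
  obtain ⟨t, ht, hcov⟩ := hcomp.elim_nhds_subcover (fun K => Metric.ball K (δ K))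
    fun K hK => Metric.ball_mem_nhds K (hδ K hK.1)
  -- The extra bracket serves the sets that miss `B`; adding `Bᶜ` to the other upper ends covers the
  -- unbounded parts.
  refine ⟨insert (∅, Bᶜ) ((fun K => (C K, U K ∪ Bᶜ)) '' (t : Set (NonemptyCompacts E))),
    (t.finite_toSet.image _).insert _, ?_, fun A hA => ?_⟩
  · rintro p (rfl | ⟨K, hK, rfl⟩)
    · exact ⟨MeasurableSet.empty, hB.measurableSet.compl,
        hQB.trans (le_add_left le_add_self)⟩
    · have hKc := (ht K hK).1
      refine ⟨hC K hKc, (hU K hKc).union hB.measurableSet.compl, ?_⟩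
      calc Q (U K ∪ Bᶜ) ≤ Q (U K) + Q Bᶜ := measure_union_le _ _
        _ ≤ Q (C K) + (ε + ε) + ε := add_le_add (hCU K hKc) hQB
        _ = _ := add_assoc _ _ _
  · rcases (A ∩ B).eq_empty_or_nonempty with hE | hN
    · exact ⟨_, Set.mem_insert _ _, Set.empty_subset _,
        fun x hx hxB => Set.eq_empty_iff_forall_notMem.1 hE x ⟨hx, hxB⟩⟩
    · have hAB : Convex ℝ (A ∩ B) := hA.inter (convex_closedBall 0 R)
      have hclB : closure (A ∩ B) ⊆ B :=
        closure_minimal Set.inter_subset_right Metric.isClosed_closedBall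
      let L : NonemptyCompacts E :=
        ⟨⟨closure (A ∩ B), hB.of_isClosed_subset isClosed_closure hclB⟩, hN.closure⟩
      have hLc : Convex ℝ (L : Set E) := hAB.closure
      obtain ⟨K, hK, hLK⟩ := Set.mem_iUnion₂.1 (hcov ⟨hLc, hclB⟩ : L ∈ _)
      obtain ⟨h1, h2⟩ := hloc K (ht K hK).1 L hLc hLK
      refine ⟨_, Set.mem_insert_of_mem _ ⟨K, hK, rfl⟩, ?_, fun x hx => ?_⟩
      · exact h1.trans ((interior_closure_subset_of_convex hAB).trans Set.inter_subset_left)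
      · by_cases hxB : x ∈ B
        · exact Or.inl (h2 (subset_closure ⟨hx, hxB⟩))
        · exact Or.inr hxB

end ConvexBrackets

/-! ### From averages and brackets to the empirical ratio. -/

section Empirical

variable {α : Type*}

theorem empirical_eq_div (y : ℕ → List α) (n : ℕ) (hn : n ≠ 0) (A : Set α) :
    empirical y n A = ((∑ i ∈ Finset.range n, (hits A (y i) : ℝ)) / n) /
      ((∑ i ∈ Finset.range n, ((y i).length : ℝ)) / n) := by
  rw [empirical, div_div_div_cancel_right₀ (Nat.cast_ne_zero.2 hn)]

theorem empirical_mono (y : ℕ → List α) (n : ℕ) {A B : Set α} (h : A ⊆ B) :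
    empirical y n A ≤ empirical y n B :=
  div_le_div_of_nonneg_right
    (Finset.sum_le_sum fun i _ => Nat.cast_le.2 (hits_mono h (y i)))
    (Finset.sum_nonneg fun _ _ => Nat.cast_nonneg _)

theorem tendsto_empirical {y : ℕ → List α} {m q : ℝ} (hm : 0 < m)
    (hlen : Tendsto (fun n : ℕ => (∑ i ∈ Finset.range n, ((y i).length : ℝ)) / n) atTop (𝓝 m))
    {A : Set α}
    (hA : Tendsto (fun n : ℕ => (∑ i ∈ Finset.range n, (hits A (y i) : ℝ)) / n) atTop
      (𝓝 (m * q))) :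
    Tendsto (fun n => empirical y n A) atTop (𝓝 q) := by
  have h := hA.div hlen hm.ne'
  rw [mul_div_cancel_left₀ q hm.ne'] at h
  refine h.congr' ?_
  filter_upwards [eventually_ne_atTop 0] with n hn
  exact (empirical_eq_div y n hn A).symm

/-- Dividing by the random mean length costs at most `|m - c n|` in the numerator, uniformly in `A`
because `q ≤ 1`. -/
theorem tendsto_iSup_empirical_of_uniform {𝒜 : Set (Set α)} {y : ℕ → List α} {m : ℝ} (hm : 0 < m)
    (hlen : Tendsto (fun n : ℕ => (∑ i ∈ Finset.range n, ((y i).length : ℝ)) / n) atTop (𝓝 m))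
    {q : Set α → ℝ} (hq0 : ∀ A, 0 ≤ q A) (hq1 : ∀ A, q A ≤ 1) {b : ℕ → ℝ}
    (hb : Tendsto b atTop (𝓝 0))
    (hbA : ∀ n, 0 < n → ∀ A ∈ 𝒜,
      |(∑ i ∈ Finset.range n, (hits A (y i) : ℝ)) / n - m * q A| ≤ b n) :
    Tendsto (fun n : ℕ => ⨆ A : 𝒜, |empirical y n (A : Set α) - q (A : Set α)|) atTop (𝓝 0) := by
  set c : ℕ → ℝ := fun n => (∑ i ∈ Finset.range n, ((y i).length : ℝ)) / n with hc
  have hlim : Tendsto (fun n => (|b n| + |m - c n|) / c n) atTop (𝓝 0) := by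
    have h := (hb.abs.add ((hlen.const_sub m).abs)).div hlen hm.ne'
    simpa [Pi.div_def] using h
  refine squeeze_zero' (Eventually.of_forall fun n => Real.iSup_nonneg fun _ => abs_nonneg _)
    ?_ hlim
  filter_upwards [eventually_gt_atTop 0, hlen.eventually (lt_mem_nhds hm)] with n hn hcn
  refine Real.iSup_le (fun A => ?_) (by positivity)
  rw [empirical_eq_div y n hn.ne']
  change |_ / c n - _| ≤ _
  have e : ∀ a : ℝ, a / c n - q A = ((a - m * q A) + q A * (m - c n)) / c n := fun a => by
    field_simp
    ring
  rw [e, abs_div, abs_of_pos hcn]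
  refine div_le_div_of_nonneg_right ((abs_add_le _ _).trans (add_le_add ?_ ?_)) hcn.le
  · exact (hbA n hn A A.2).trans (le_abs_self _)
  · rw [abs_mul, abs_of_nonneg (hq0 _)]
    exact mul_le_of_le_one_left (abs_nonneg _) (hq1 _)

/-- Both set functions are monotone, so the error at `A` is at most the bracket width plus the error
at an endpoint. The members of `𝒜` need no measurability. -/
theorem tendsto_iSup_empirical_of_brackets {𝒜 : Set (Set α)} {y : ℕ → List α} {q : Set α → ℝ}
    (hq : Monotone q)
    (h : ∀ ε > 0, ∃ ℱ : Set (Set α × Set α), ℱ.Finite ∧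
      (∀ p ∈ ℱ, Tendsto (fun n => empirical y n p.1) atTop (𝓝 (q p.1)) ∧
        Tendsto (fun n => empirical y n p.2) atTop (𝓝 (q p.2)) ∧ q p.2 ≤ q p.1 + ε) ∧
      ∀ A ∈ 𝒜, ∃ p ∈ ℱ, p.1 ⊆ A ∧ A ⊆ p.2) :
    Tendsto (fun n : ℕ => ⨆ A : 𝒜, |empirical y n (A : Set α) - q (A : Set α)|) atTop (𝓝 0) := by
  rw [Metric.tendsto_atTop']
  intro ε hε
  obtain ⟨ℱ, hfin, hℱ, hcov⟩ := h (ε / 3) (by positivity)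
  have hev : ∀ᶠ n in atTop, ∀ p ∈ ℱ, q p.1 - ε / 3 < empirical y n p.1 ∧
      empirical y n p.2 < q p.2 + ε / 3 := by
    rw [hfin.eventually_all]
    intro p hp
    obtain ⟨h1, h2, -⟩ := hℱ p hp
    exact (h1.eventually (lt_mem_nhds (by linarith))).and
      (h2.eventually (gt_mem_nhds (by linarith)))
  obtain ⟨N, hN⟩ := eventually_atTop.1 hev
  refine ⟨N, fun n hn => ?_⟩
  rw [Real.dist_eq, sub_zero, abs_of_nonneg (Real.iSup_nonneg fun _ => abs_nonneg _)]
  refine lt_of_le_of_lt (Real.iSup_le (fun A => ?_) (by positivity)) (by linarith : 2 * ε / 3 < ε)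
  obtain ⟨p, hp, hpA, hAp⟩ := hcov A A.2
  obtain ⟨h1, h2⟩ := hN n hn.le p hp
  have h3 := (hℱ p hp).2.2
  have h4 := hq hpA
  have h5 := hq hAp
  have h6 := empirical_mono y n hpA
  have h7 := empirical_mono y n hAp
  rw [abs_le]
  constructor <;> linarith

end Empirical

end GS

/-! ### The main theorem. -/

theorem theorem4 {d : ℕ}
    -- the density `f` of `Y` and the importance function `S`
    (f : EuclideanSpace ℝ (Fin d) → ℝ) (hf : Measurable f) (hf_nonneg : ∀ y, 0 ≤ f y)
    (hf_one : ∫⁻ y, ENNReal.ofReal (f y) = 1)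
    (S : EuclideanSpace ℝ (Fin d) → ℝ) (hS : Measurable S)
    -- the law `μ` of `Y`
    (μ : Measure (EuclideanSpace ℝ (Fin d)))
    (hμ : μ = volume.withDensity fun y => ENNReal.ofReal (f y))
    -- the splitting factor and the levels; the event `S(Y) ≥ γ τ` has positive probability
    (s τ : ℕ) (hs : 2 ≤ s) (hτ : 1 ≤ τ)
    (γ : ℕ → ℝ) (hγ : StrictMonoOn γ (Set.Icc 1 τ))
    (hpos : 0 < μ {y | γ τ ≤ S y})
    -- the transition kernels `κ 1, …, κ (τ - 1)`, with their stationary laws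
    (κ : ℕ → Kernel (EuclideanSpace ℝ (Fin d)) (EuclideanSpace ℝ (Fin d)))
    [∀ l, IsMarkovKernel (κ l)]
    (hκ : ∀ l, 1 ≤ l → l < τ → (κ l).Invariant (GS.truncatedLaw μ S (γ l)))
    -- the independent replications of the sampler
    {Ω : Type*} [MeasurableSpace Ω] (P : Measure Ω) [IsProbabilityMeasure P]
    (Y : ℕ → Ω → List (EuclideanSpace ℝ (Fin d)))
    (hY_law : ∀ i, HasLaw (Y i) (GS.samplerLaw μ s τ S γ κ) P)
    (hY_indep : iIndepFun Y P)
    -- the class of sets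
    (𝒜 : Set (Set (EuclideanSpace ℝ (Fin d))))
    (h𝒜 : (GS.vcDim 𝒜 < ⊤ ∧ (∀ A ∈ 𝒜, MeasurableSet A) ∧ GS.IsMeasurableClass 𝒜) ∨
      (𝒜 = {A | Convex ℝ A} ∧
        ∀ l, 1 ≤ l → l < τ → GS.HasTransitionDensity (κ l) (GS.truncatedLaw μ S (γ l)))) :
    ∀ᵐ ω ∂P, Tendsto
      (fun n : ℕ => ⨆ A : 𝒜, |GS.empirical (fun i => Y i ω) n (A : Set (EuclideanSpace ℝ (Fin d))) -
        (GS.truncatedLaw μ S (γ τ)).real (A : Set (EuclideanSpace ℝ (Fin d)))|)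
      atTop (𝓝 0) := by
  obtain ⟨l, rfl⟩ : ∃ l, τ = l + 1 := ⟨τ - 1, by lia⟩
  have hs0 : s ≠ 0 := by lia
  have : IsProbabilityMeasure μ := ⟨by
    rw [hμ, withDensity_apply _ MeasurableSet.univ, Measure.restrict_univ, hf_one]⟩
  have hQP : IsProbabilityMeasure (GS.truncatedLaw μ S (γ (l + 1))) :=
    cond_isProbabilityMeasure hpos.ne'
  set Q := GS.truncatedLaw μ S (γ (l + 1))
  have := GS.isProbabilityMeasure_samplerLaw hS hs0 hγ hκ hpos
  obtain ⟨m, hm, hmean⟩ := GS.integral_hits_samplerLaw hS hs0 hγ hκ hpos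
  have hM : ∀ᵐ L ∂GS.samplerLaw μ s (l + 1) S γ κ, L.length ≤ s ^ l := GS.ae_length_samplerLaw hS
  set ν := GS.samplerLaw μ s (l + 1) S γ κ
  have hlaw : HasLaw (fun ω i => Y i ω) (Measure.infinitePi fun _ : ℕ => ν) P :=
    iIndepFun.hasLaw_infinitePi hY_law hY_indep
      (aemeasurable_pi_iff.2 fun i => (hY_law i).aemeasurable)
  have hlen : ∀ᵐ y ∂Measure.infinitePi (fun _ : ℕ => ν), Tendsto
      (fun n : ℕ => (∑ i ∈ Finset.range n, ((y i).length : ℝ)) / n) atTop (𝓝 m) := by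
    have h := GS.ae_tendsto_hits ν hM MeasurableSet.univ
    rw [hmean _ MeasurableSet.univ] at h
    simpa [GS.hits_univ] using h
  -- The replications have the product law, so it is enough to argue on the canonical sequence
  -- space; only null sets are transferred.
  suffices h : ∀ᵐ y ∂Measure.infinitePi (fun _ : ℕ => ν), Tendsto (fun n : ℕ => ⨆ A : 𝒜,
      |GS.empirical y n (A : Set (EuclideanSpace ℝ (Fin d))) -
        Q.real (A : Set (EuclideanSpace ℝ (Fin d)))|) atTop (𝓝 0) by
    rw [← hlaw.map_eq] at h
    exact ae_of_ae_map hlaw.aemeasurable h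
  rcases h𝒜 with ⟨hvc, hborel, hmeas⟩ | ⟨rfl, -⟩
  · filter_upwards [hlen, GS.ae_exists_uniform_bound hmeas hvc hborel
      (Nat.pow_pos (Nat.pos_of_ne_zero hs0)) hM] with y hy ⟨b, hb, hbA⟩
    refine GS.tendsto_iSup_empirical_of_uniform hm hy (q := Q.real) (fun _ => measureReal_nonneg)
      (fun _ => measureReal_le_one) hb fun n hn A hA => ?_
    rw [← hmean A (hborel A hA)]
    exact hbA n hn A hA
  · have hQ : ∀ A : Set (EuclideanSpace ℝ (Fin d)), Convex ℝ A → Q (frontier A) = 0 := by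
      intro A hA
      have hac : Q ≪ volume :=
        cond_absolutelyContinuous.trans (hμ ▸ withDensity_absolutelyContinuous _ _)
      exact hac (hA.addHaar_frontier volume)
    have hε : ∀ k : ℕ, ENNReal.ofReal (1 / ((k : ℝ) + 1)) ≠ 0 := fun k => by
      rw [ENNReal.ofReal_ne_zero_iff]
      positivity
    -- Brackets are fixed for countably many tolerances before the sample, so one null set serves
    -- all endpoints.
    choose ℱ hfin hℱ hcov using fun k => GS.exists_finite_brackets Q hQ (hε k)
    have hconv : ∀ A : Set (EuclideanSpace ℝ (Fin d)), MeasurableSet A →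
        ∀ᵐ y ∂Measure.infinitePi (fun _ : ℕ => ν),
          Tendsto (fun n => GS.empirical y n A) atTop (𝓝 (Q.real A)) := by
      intro A hA
      have h := GS.ae_tendsto_hits ν hM hA
      rw [hmean A hA] at h
      filter_upwards [hlen, h] with y hy hyA
      exact GS.tendsto_empirical hm hy hyA
    have hall : ∀ᵐ y ∂Measure.infinitePi (fun _ : ℕ => ν), ∀ k, ∀ p ∈ ℱ k,
        Tendsto (fun n => GS.empirical y n p.1) atTop (𝓝 (Q.real p.1)) ∧
        Tendsto (fun n => GS.empirical y n p.2) atTop (𝓝 (Q.real p.2)) := by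
      refine ae_all_iff.2 fun k => (ae_ball_iff (hfin k).countable).2 fun p hp => ?_
      filter_upwards [hconv p.1 (hℱ k p hp).1, hconv p.2 (hℱ k p hp).2.1] with y h1 h2
      exact ⟨h1, h2⟩
    filter_upwards [hall] with y hy
    refine GS.tendsto_iSup_empirical_of_brackets (q := Q.real) (fun _ _ h => measureReal_mono h)
      fun ε hε0 => ?_
    -- A bracket is up to three tolerances wide.
    obtain ⟨k, hk⟩ := exists_nat_one_div_lt (show 0 < ε / 3 by positivity)
    refine ⟨ℱ k, hfin k, fun p hp => ⟨(hy k p hp).1, (hy k p hp).2, ?_⟩, fun A hA => hcov k A hA⟩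
    have h0 : (0 : ℝ) ≤ 1 / ((k : ℝ) + 1) := by positivity
    have h := (hℱ k p hp).2.2
    rw [← ENNReal.ofReal_add h0 h0, ← ENNReal.ofReal_add (add_nonneg h0 h0) h0,
      ← ofReal_measureReal (μ := Q) (s := p.1), ← ofReal_measureReal (μ := Q) (s := p.2),
      ← ENNReal.ofReal_add measureReal_nonneg (by positivity),
      ENNReal.ofReal_le_ofReal_iff (add_nonneg measureReal_nonneg (by positivity))] at h
    linarith
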